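/- Let $\mu$ be a Borel probability measure on $\mathbb{R}^d$, let $x_1, x_2, \dots$ be independent random points with law $\mu$, let $\alpha > 0$, and let $E_\alpha = \limsup_n B(x_n, n^{-\alpha})$, where $B(x,r)$ is the open ball. For $r>0$ and $t\in\mathbb{R}$ let $N(t,r)$ be the number of cubes $Q=[k_1 r,(k_1+1)r)\times\cdots\times[k_d r,(k_d+1)r)$, $k_i\in\mathbb{Z}$, with $\mu(Q)\ge r^t$. Let $$G_\mu(t)=\lim_{\varepsilon\to0^+}\limsup_{r\to0^+}\frac{\log\bigl(N(t+\varepsilon,r)-N(t-\varepsilon,r)\bigr)}{-\log r}\qquad(\log 0=-\infty)$$ be the upper coarse multifractal spectrum of $\mu$, and let $$s=s(\mu)=\lim_{\varepsilon\to0^+}\sup\{\,t\in\mathbb{R}: G_\mu(t)\ge t-\varepsilon\,\}.$$ Let $\overline{\dim}_H\,\mu$ be the $\mu$-essential supremum of the lower local dimension $\underline d_\mu(x)=\liminf_{r\to0^+}\log\mu(B(x,r))/\log r$. For a point $p\in\mathbb{R}^d$ let $\mathcal{D}=\mathcal{D}(p)$ be the collection of the dyadic cubes $\prod_{i=1}^d[p_i+k_i2^{-n},p_i+(k_i+1)2^{-n})$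 with $n,k_1,\dots,k_d\in\mathbb{Z}$. For $0<\eta\le1$ and $E\subset\mathbb{R}^d$ let $\mathcal{M}_\mu^\eta(E)$ be the infimum of $\sum_k\mu(D_k)^\eta$ over all countable covers $(D_k)$ of $E$ by elements of $\mathcal{D}$. For $0<\theta\le1$ let $\mathcal{G}_\mu^\theta$ be the class of all $G_\delta$-sets $E$ such that $\mathcal{M}_\mu^\eta(E\cap D)=\mathcal{M}_\mu^\eta(D)$ for all $0<\eta<\theta$ and all $D\in\mathcal{D}$. Suppose that $s<\infty$ (this holds, for instance, whenever $\mu$ has bounded support) and that $1/\alpha\le s$. Then: 1. for every $p$ such that the boundaries of the cubes in $\mathcal{D}(p)$ have $\mu$-measure $0$, almost surely $E_\alpha\in\mathcal{G}_\mu^\theta$ with $\theta=1/(\alpha s)$; 2. almost surely $$\dim_H E_\alpha\ \ge\ \frac1\alpha\,\frac{\overline{\dim}_H\,\mu}{s}.$$ -/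

import Mathlib

open Filter Topology MeasureTheory ProbabilityTheory
open scoped ENNReal

noncomputable section

namespace RandomLimsup

/-- The half-open cube of side `r` with integer index `k` in the grid anchored at `p`:
`∏ i, [p i + k i * r, p i + (k i + 1) * r)`. -/
def gridCube {d : ℕ} (p : EuclideanSpace ℝ (Fin d)) (r : ℝ) (k : Fin d → ℤ) :
    Set (EuclideanSpace ℝ (Fin d)) :=
  {x | ∀ i, p i + k i * r ≤ x i ∧ x i < p i + (k i + 1) * r}

/-- The dyadic cubes of all levels `n ∈ ℤ` (side `2 ^ (-n)`), based at the point `p`. -/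
def dyadicCubes {d : ℕ} (p : EuclideanSpace ℝ (Fin d)) :
    Set (Set (EuclideanSpace ℝ (Fin d))) :=
  {D | ∃ (n : ℤ) (k : Fin d → ℤ), D = gridCube p ((2 : ℝ) ^ (-n)) k}

/-- The union of the boundaries of all dyadic cubes based at `p`. -/
def dyadicBoundary {d : ℕ} (p : EuclideanSpace ℝ (Fin d)) : Set (EuclideanSpace ℝ (Fin d)) :=
  ⋃ D ∈ dyadicCubes p, frontier D

/-- The set function `M_μ^η`: the infimum of `∑ μ(D)^η` over all countable (finite or infinite)
covers of `E` by dyadic cubes based at `p`. -/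
def netContent {d : ℕ} (p : EuclideanSpace ℝ (Fin d)) (μ : Measure (EuclideanSpace ℝ (Fin d)))
    (η : ℝ) (E : Set (EuclideanSpace ℝ (Fin d))) : ℝ≥0∞ :=
  ⨅ (C : Set (Set (EuclideanSpace ℝ (Fin d)))) (_ : C.Countable) (_ : C ⊆ dyadicCubes p)
    (_ : E ⊆ ⋃₀ C), ∑' D : C, μ (D : Set (EuclideanSpace ℝ (Fin d))) ^ η

/-- The class `G_μ^θ` (for dyadic cubes based at `p`), used for `0 < θ ≤ 1`. -/
def classG {d : ℕ} (p : EuclideanSpace ℝ (Fin d)) (μ : Measure (EuclideanSpace ℝ (Fin d)))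
    (θ : ℝ) : Set (Set (EuclideanSpace ℝ (Fin d))) :=
  {E | IsGδ E ∧ ∀ η : ℝ, 0 < η → η < θ → ∀ D ∈ dyadicCubes p,
    netContent p μ η (E ∩ D) = netContent p μ η D}

/-- The indices of the cubes `[k₁ r, (k₁ + 1) r) × ⋯ × [k_d r, (k_d + 1) r)` of `μ`-measure at
least `r ^ t`. -/
def heavyCubes {d : ℕ} (μ : Measure (EuclideanSpace ℝ (Fin d))) (t r : ℝ) : Set (Fin d → ℤ) :=
  {k | ENNReal.ofReal (r ^ t) ≤ μ (gridCube 0 r k)}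

/-- `N(t, r)`, the number of those cubes. It is finite for a finite measure and `r > 0`,
see `heavyCubes_finite`. -/
def cubeCount {d : ℕ} (μ : Measure (EuclideanSpace ℝ (Fin d))) (t r : ℝ) : ℕ :=
  (heavyCubes μ t r).ncard

/-- `limsup_{r → 0+} log (N(t + ε, r) - N(t - ε, r)) / (-log r)`, where `log 0 = -∞`.
For `0 < r < 1` and `ε ≥ 0` the subtraction does not truncate. -/
def coarseGrowth {d : ℕ} (μ : Measure (EuclideanSpace ℝ (Fin d))) (t ε : ℝ) : EReal :=
  limsup (fun r : ℝ =>
    ENNReal.log ((cubeCount μ (t + ε) r - cubeCount μ (t - ε) r : ℕ) : ℝ≥0∞)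
      / ((-Real.log r : ℝ) : EReal)) (𝓝[>] (0 : ℝ))

/-- The upper coarse multifractal spectrum `G_μ(t)`, the limit of `coarseGrowth μ t ε` as
`ε → 0+`. The limit exists, see `tendsto_coarseGrowth`. -/
def coarseSpectrum {d : ℕ} (μ : Measure (EuclideanSpace ℝ (Fin d))) (t : ℝ) : EReal :=
  limUnder (𝓝[>] (0 : ℝ)) (fun ε : ℝ => coarseGrowth μ t ε)

/-- `sup {t : G_μ(t) ≥ t - ε}`, in the extended reals. -/
def thresholdSup {d : ℕ} (μ : Measure (EuclideanSpace ℝ (Fin d))) (ε : ℝ) : EReal :=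
  ⨆ t ∈ {t : ℝ | ((t - ε : ℝ) : EReal) ≤ coarseSpectrum μ t}, (t : EReal)

/-- `s(μ) = lim_{ε → 0+} sup {t : G_μ(t) ≥ t - ε}`. The limit exists in the extended reals,
see `tendsto_thresholdSup`. -/
def criticalExponent {d : ℕ} (μ : Measure (EuclideanSpace ℝ (Fin d))) : EReal :=
  limUnder (𝓝[>] (0 : ℝ)) (fun ε : ℝ => thresholdSup μ ε)

/-- The lower local dimension `liminf_{r → 0+} log μ(B(x,r)) / log r` (with `log 0 = -∞`, so that
it is `+∞` outside the support of `μ`). -/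
def lowerLocalDim {d : ℕ} (μ : Measure (EuclideanSpace ℝ (Fin d)))
    (x : EuclideanSpace ℝ (Fin d)) : EReal :=
  liminf (fun r : ℝ => ENNReal.log (μ (Metric.ball x r)) / ((Real.log r : ℝ) : EReal))
    (𝓝[>] (0 : ℝ))

/-- The upper Hausdorff dimension of `μ`: the essential supremum of the lower local dimension. -/
def upperHausdorffDim {d : ℕ} (μ : Measure (EuclideanSpace ℝ (Fin d))) : EReal :=
  essSup (lowerLocalDim μ) μ

/-- `limsup_n B(x_n, n^{-α})`, `n = 1, 2, …`; the point `x_n` is `x (n - 1)`. -/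
def limsupBalls {d : ℕ} (α : ℝ) (x : ℕ → EuclideanSpace ℝ (Fin d)) :
    Set (EuclideanSpace ℝ (Fin d)) :=
  limsup (fun n : ℕ => Metric.ball (x n) (((n : ℝ) + 1) ^ (-α))) atTop

/-! The limits above exist. -/

lemma measurableSet_gridCube {d : ℕ} (p : EuclideanSpace ℝ (Fin d)) (r : ℝ) (k : Fin d → ℤ) :
    MeasurableSet (gridCube p r k) := by
  have : gridCube p r k = ⋂ i, ({x : EuclideanSpace ℝ (Fin d) | p i + k i * r ≤ x i} ∩
      {x : EuclideanSpace ℝ (Fin d) | x i < p i + (k i + 1) * r}) := by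
    ext x; simp [gridCube]
  rw [this]
  refine MeasurableSet.iInter fun i => ?_
  have hc : Continuous fun x : EuclideanSpace ℝ (Fin d) => x i := by fun_prop
  exact (isClosed_le continuous_const hc).measurableSet.inter
    (isOpen_lt hc continuous_const).measurableSet

lemma disjoint_gridCube {d : ℕ} (p : EuclideanSpace ℝ (Fin d)) {r : ℝ} (hr : 0 < r) :
    Pairwise (Function.onFun Disjoint (gridCube p r)) := by
  intro k l hkl
  refine Set.disjoint_left.2 fun x hx hy => hkl (funext fun i => ?_)
  obtain ⟨h1, h2⟩ := hx i
  obtain ⟨h3, h4⟩ := hy i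
  have h5 : (k i : ℝ) < l i + 1 := lt_of_mul_lt_mul_right (by linarith) hr.le
  have h6 : (l i : ℝ) < k i + 1 := lt_of_mul_lt_mul_right (by linarith) hr.le
  have h7 : k i < l i + 1 := by exact_mod_cast h5
  have h8 : l i < k i + 1 := by exact_mod_cast h6
  omega

lemma heavyCubes_finite {d : ℕ} (μ : Measure (EuclideanSpace ℝ (Fin d))) [IsFiniteMeasure μ]
    (t : ℝ) {r : ℝ} (hr : 0 < r) : (heavyCubes μ t r).Finite := by
  refine Measure.finite_const_le_meas_of_disjoint_iUnion μ
    (ENNReal.ofReal_pos.2 (Real.rpow_pos_of_pos hr t))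
    (fun k => measurableSet_gridCube 0 r k) (disjoint_gridCube 0 hr) (measure_ne_top _ _)

lemma cubeCount_mono {d : ℕ} (μ : Measure (EuclideanSpace ℝ (Fin d))) [IsFiniteMeasure μ]
    {t u r : ℝ} (htu : t ≤ u) (hr : 0 < r) (hr1 : r < 1) :
    cubeCount μ t r ≤ cubeCount μ u r := by
  refine Set.ncard_le_ncard (fun k hk => ?_) (heavyCubes_finite μ u hr)
  exact le_trans (ENNReal.ofReal_le_ofReal
    (Real.rpow_le_rpow_of_exponent_ge hr hr1.le htu)) hk

lemma coarseGrowth_mono {d : ℕ} (μ : Measure (EuclideanSpace ℝ (Fin d))) [IsFiniteMeasure μ]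
    (t : ℝ) : Monotone (coarseGrowth μ t) := by
  intro ε ε' h
  refine limsup_le_limsup ?_
  have h1 : ∀ᶠ r : ℝ in 𝓝[>] (0 : ℝ), r < 1 :=
    eventually_nhdsWithin_of_eventually_nhds (eventually_lt_nhds one_pos)
  filter_upwards [h1, self_mem_nhdsWithin] with r hr1 hr
  have hr0 : 0 < r := hr
  have hlog : 0 ≤ -Real.log r := by
    have := Real.log_neg hr0 hr1
    linarith
  refine EReal.div_le_div_right_of_nonneg (by exact_mod_cast hlog) ?_
  refine ENNReal.log_monotone ?_
  have ha := cubeCount_mono μ (show t + ε ≤ t + ε' by linarith) hr0 hr1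
  have hb := cubeCount_mono μ (show t - ε' ≤ t - ε by linarith) hr0 hr1
  exact Nat.cast_le.2 (by omega)

lemma tendsto_coarseGrowth {d : ℕ} (μ : Measure (EuclideanSpace ℝ (Fin d))) [IsFiniteMeasure μ]
    (t : ℝ) : Tendsto (fun ε : ℝ => coarseGrowth μ t ε) (𝓝[>] (0 : ℝ))
      (𝓝 (coarseSpectrum μ t)) :=
  tendsto_nhds_limUnder ⟨_, (coarseGrowth_mono μ t).tendsto_nhdsGT 0⟩

lemma thresholdSup_mono {d : ℕ} (μ : Measure (EuclideanSpace ℝ (Fin d))) :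
    Monotone (thresholdSup μ) := by
  intro ε ε' h
  refine biSup_mono fun t ht => ?_
  have h1 : ((t - ε' : ℝ) : EReal) ≤ ((t - ε : ℝ) : EReal) :=
    EReal.coe_le_coe_iff.2 (by linarith)
  exact h1.trans ht

lemma tendsto_thresholdSup {d : ℕ} (μ : Measure (EuclideanSpace ℝ (Fin d))) :
    Tendsto (fun ε : ℝ => thresholdSup μ ε) (𝓝[>] (0 : ℝ)) (𝓝 (criticalExponent μ)) :=
  tendsto_nhds_limUnder ⟨_, (thresholdSup_mono μ).tendsto_nhdsGT 0⟩

end RandomLimsup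

end

noncomputable section

namespace RandomLimsup

/-! Let `ν` be `μ` restricted to a measurable set `A`. The core is: if `η * s < 1/α`, then almost
surely the limsup set has full content `ν(D)^η` in every dyadic cube `D`. With `A` the whole space
this gives the first claim, with `A` the closure of a Frostman set the second.

Reduction to open sets (`le_netContent_iInter`) is a Baire argument. A cover of the intersection
that is too cheap in `D` stays too cheap near some much smaller cube inside the first open set, then
inside the second, and so on. The nested cubes lead to a point of the intersection; the member of
the cover that contains it is already expensive enough. So it suffices to treat the tail unions of
balls.

For these, take about `2^(m/α)` points whose balls contain their cubes of level `m`, and spread a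
unit mass over each such cube. `card_le_mul_netContent` is the mass distribution principle for this
mass. It needs that no cube receives many more points than expected, which follows from Chernoff's
bound and a union bound over the at most `2^(mt)` cubes per level of measure at least `2^(-mt)`.
Points in lighter cubes are discarded. Infinitely many good levels suffice, so convergence in
probability is enough.

The critical exponent makes the discarded part negligible (`tendsto_measure_light`): for `t > s` the
coarse spectrum at each `u ≥ t` is below `u - ε`, so the cubes of measure about `r^u` have vanishing
total mass. Compactness treats `u` in `[t, d+1]`, and counting cubes treats measures below
`r^(d+1)`.

For the dimension (`le_dimH_of_le_netContent`), a Frostman exponent `τ` bounds the cost `ν(D)^η` by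
a multiple of the diameter to the power `τη`, so full content rules out zero Hausdorff measure in
that dimension. Finally `τ` and `η` increase to the upper Hausdorff dimension and to `θ`. -/

variable {d : ℕ}

/-! ### Geometry of dyadic cubes -/

/-- The dyadic cube of level `m` and index `k` based at `p`. -/
abbrev dyadicCube (p : EuclideanSpace ℝ (Fin d)) (m : ℤ) (k : Fin d → ℤ) :
    Set (EuclideanSpace ℝ (Fin d)) :=
  gridCube p ((2 : ℝ) ^ (-m)) k

/-- The index of the level `m` dyadic cube that contains `x`. -/
def cubeIdx (p : EuclideanSpace ℝ (Fin d)) (m : ℤ) (x : EuclideanSpace ℝ (Fin d)) : Fin d → ℤ :=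
  fun i => ⌊(x i - p i) * (2 : ℝ) ^ m⌋

/-- The level `m` dyadic cube that contains `x`. -/
def cubeAt (p : EuclideanSpace ℝ (Fin d)) (m : ℤ) (x : EuclideanSpace ℝ (Fin d)) :
    Set (EuclideanSpace ℝ (Fin d)) :=
  dyadicCube p m (cubeIdx p m x)

lemma mem_dyadicCube_iff {p : EuclideanSpace ℝ (Fin d)} {m : ℤ} {k : Fin d → ℤ}
    {x : EuclideanSpace ℝ (Fin d)} : x ∈ dyadicCube p m k ↔ cubeIdx p m x = k := by
  have h2 : (0 : ℝ) < 2 ^ m := by positivity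
  rw [funext_iff]
  refine forall_congr' fun i => ?_
  rw [cubeIdx, Int.floor_eq_iff, zpow_neg, ← div_eq_mul_inv, ← div_eq_mul_inv,
    ← le_sub_iff_add_le', ← sub_lt_iff_lt_add', div_le_iff₀ h2, lt_div_iff₀ h2]

lemma mem_cubeAt (p : EuclideanSpace ℝ (Fin d)) (m : ℤ) (x : EuclideanSpace ℝ (Fin d)) :
    x ∈ cubeAt p m x :=
  mem_dyadicCube_iff.2 rfl

lemma cubeAt_eq_of_mem {p : EuclideanSpace ℝ (Fin d)} {m : ℤ} {k : Fin d → ℤ}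
    {x : EuclideanSpace ℝ (Fin d)} (h : x ∈ dyadicCube p m k) : dyadicCube p m k = cubeAt p m x := by
  rw [cubeAt, mem_dyadicCube_iff.1 h]

lemma cubeAt_congr {p : EuclideanSpace ℝ (Fin d)} {m : ℤ}
    {x y : EuclideanSpace ℝ (Fin d)} (h : y ∈ cubeAt p m x) : cubeAt p m x = cubeAt p m y :=
  cubeAt_eq_of_mem h

/-- The coarse index is the integer quotient of the fine one by a power of two; this is the source
of all nesting of cubes. -/
lemma cubeIdx_eq_of_le {p : EuclideanSpace ℝ (Fin d)} {m n : ℤ} (hmn : m ≤ n)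
    {x y : EuclideanSpace ℝ (Fin d)} (h : cubeIdx p n x = cubeIdx p n y) :
    cubeIdx p m x = cubeIdx p m y := by
  obtain ⟨j, rfl⟩ := Int.le.dest hmn
  funext i
  have hi := congrFun h i
  simp only [cubeIdx] at hi ⊢
  have key : ∀ a : ℝ, ⌊a * (2 : ℝ) ^ m⌋ = ⌊a * (2 : ℝ) ^ (m + j)⌋ / (2 ^ j : ℕ) := by
    intro a
    rw [zpow_add₀ (by norm_num), zpow_natCast, ← mul_assoc, ← Int.floor_div_natCast]
    congr 1
    push_cast
    field_simp
  rw [key, key, hi]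

lemma dyadicCube_subset_of_le {p : EuclideanSpace ℝ (Fin d)} {m n : ℤ} (hmn : m ≤ n)
    {k l : Fin d → ℤ} {x : EuclideanSpace ℝ (Fin d)} (hk : x ∈ dyadicCube p m k)
    (hl : x ∈ dyadicCube p n l) : dyadicCube p n l ⊆ dyadicCube p m k := by
  intro y hy
  rw [mem_dyadicCube_iff] at *
  rw [← hk]
  exact cubeIdx_eq_of_le hmn (hy.trans hl.symm)

lemma dyadicCube_nonempty (p : EuclideanSpace ℝ (Fin d)) (m : ℤ) (k : Fin d → ℤ) :
    (dyadicCube p m k).Nonempty := by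
  refine ⟨WithLp.toLp 2 fun i => p i + k i * (2 : ℝ) ^ (-m), fun i => ⟨le_rfl, ?_⟩⟩
  have h2 : (0 : ℝ) < 2 ^ (-m) := by positivity
  simp only
  nlinarith

lemma dyadicCube_mem (p : EuclideanSpace ℝ (Fin d)) (m : ℤ) (k : Fin d → ℤ) :
    dyadicCube p m k ∈ dyadicCubes p :=
  ⟨m, k, rfl⟩

lemma cubeAt_mem (p : EuclideanSpace ℝ (Fin d)) (m : ℤ) (x : EuclideanSpace ℝ (Fin d)) :
    cubeAt p m x ∈ dyadicCubes p :=
  ⟨m, _, rfl⟩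

lemma countable_dyadicCubes (p : EuclideanSpace ℝ (Fin d)) : (dyadicCubes p).Countable := by
  have : dyadicCubes p = Set.range fun q : ℤ × (Fin d → ℤ) => dyadicCube p q.1 q.2 := by
    ext D
    simp only [dyadicCubes, Set.mem_ofPred_eq, Set.mem_range, Prod.exists, eq_comm]
  rw [this]
  exact Set.countable_range _

lemma nonempty_of_mem_dyadicCubes {p : EuclideanSpace ℝ (Fin d)}
    {D : Set (EuclideanSpace ℝ (Fin d))} (hD : D ∈ dyadicCubes p) : D.Nonempty := by
  obtain ⟨m, k, rfl⟩ := hD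
  exact dyadicCube_nonempty p m k

/-- Two dyadic cubes that meet are nested. -/
lemma subset_or_subset_of_mem {p : EuclideanSpace ℝ (Fin d)}
    {K Q : Set (EuclideanSpace ℝ (Fin d))} (hK : K ∈ dyadicCubes p) (hQ : Q ∈ dyadicCubes p)
    {x : EuclideanSpace ℝ (Fin d)} (hxK : x ∈ K) (hxQ : x ∈ Q) : K ⊆ Q ∨ Q ⊆ K := by
  obtain ⟨m, k, rfl⟩ := hK
  obtain ⟨n, l, rfl⟩ := hQ
  rcases le_total m n with h | h
  · exact Or.inr (dyadicCube_subset_of_le h hxK hxQ)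
  · exact Or.inl (dyadicCube_subset_of_le h hxQ hxK)

lemma dist_le_of_abs_sub_le {x y : EuclideanSpace ℝ (Fin d)} {r : ℝ}
    (h : ∀ i, |x i - y i| ≤ r) : dist x y ≤ d * r := by
  rw [EuclideanSpace.dist_eq]
  have h1 : ∑ i, dist (x i) (y i) ^ 2 ≤ (∑ i, dist (x i) (y i)) ^ 2 :=
    Finset.sum_sq_le_sq_sum_of_nonneg fun i _ => dist_nonneg
  have h2 : ∑ i, dist (x i) (y i) ≤ d * r := by
    refine (Finset.sum_le_card_nsmul _ _ r fun i _ => ?_).trans (by simp)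
    rw [Real.dist_eq]
    exact h i
  refine (Real.sqrt_le_sqrt h1).trans ?_
  rwa [Real.sqrt_sq (Finset.sum_nonneg fun i _ => dist_nonneg)]

lemma dist_le_of_mem_dyadicCube {p : EuclideanSpace ℝ (Fin d)} {m : ℤ} {k : Fin d → ℤ}
    {x y : EuclideanSpace ℝ (Fin d)} (hx : x ∈ dyadicCube p m k) (hy : y ∈ dyadicCube p m k) :
    dist x y ≤ d * (2 : ℝ) ^ (-m) := by
  refine dist_le_of_abs_sub_le fun i => ?_
  have h1 := hx i
  have h2 := hy i
  rw [abs_le]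
  constructor <;> linarith

lemma closure_cubeAt_subset (p : EuclideanSpace ℝ (Fin d)) (m : ℤ)
    (x : EuclideanSpace ℝ (Fin d)) :
    closure (cubeAt p m x) ⊆ Metric.closedBall x (d * (2 : ℝ) ^ (-m)) :=
  closure_minimal (fun _ hy => dist_le_of_mem_dyadicCube hy (mem_cubeAt p m x))
    Metric.isClosed_closedBall

lemma isCompact_closure_cubeAt (p : EuclideanSpace ℝ (Fin d)) (m : ℤ)
    (x : EuclideanSpace ℝ (Fin d)) : IsCompact (closure (cubeAt p m x)) :=
  (isCompact_closedBall x _).of_isClosed_subset isClosed_closure (closure_cubeAt_subset p m x)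

lemma tendsto_two_zpow_neg : Tendsto (fun m : ℕ => (2 : ℝ) ^ (-(m : ℤ))) atTop (𝓝 0) := by
  simp only [zpow_neg, zpow_natCast]
  exact tendsto_inv_atTop_zero.comp (tendsto_pow_atTop_atTop_of_one_lt (by norm_num))

/-- A point of an open set has arbitrarily small cubes with closure in that set. -/
lemma exists_closure_cubeAt_subset (p : EuclideanSpace ℝ (Fin d)) {O : Set (EuclideanSpace ℝ (Fin d))}
    (hO : IsOpen O) {x : EuclideanSpace ℝ (Fin d)} (hx : x ∈ O) (m : ℤ) :
    ∃ j : ℕ, closure (cubeAt p (m + j) x) ⊆ O := by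
  obtain ⟨ε, hε, hεO⟩ := Metric.isOpen_iff.1 hO x hx
  have h : Tendsto (fun j : ℕ => (d * 2 ^ (-m) : ℝ) * (2 : ℝ) ^ (-(j : ℤ))) atTop (𝓝 0) := by
    simpa using tendsto_two_zpow_neg.const_mul (d * 2 ^ (-m) : ℝ)
  obtain ⟨j, hj⟩ := (h.eventually (gt_mem_nhds hε)).exists
  refine ⟨j, (closure_cubeAt_subset p _ x).trans fun y hy => hεO ?_⟩
  refine Metric.mem_ball.2 ((Metric.mem_closedBall.1 hy).trans_lt (lt_of_eq_of_lt ?_ hj))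
  rw [neg_add, zpow_add₀ (by norm_num), mul_assoc]

lemma frontier_subset_dyadicBoundary {p : EuclideanSpace ℝ (Fin d)}
    {D : Set (EuclideanSpace ℝ (Fin d))} (hD : D ∈ dyadicCubes p) :
    frontier D ⊆ dyadicBoundary p :=
  Set.subset_biUnion_of_mem (u := fun D => frontier D) hD

lemma measurable_cubeIdx (p : EuclideanSpace ℝ (Fin d)) (m : ℤ) : Measurable (cubeIdx p m) := by
  refine measurable_pi_lambda _ fun i => Int.measurable_floor.comp ?_
  have hc : Continuous fun x : EuclideanSpace ℝ (Fin d) => (x i - p i) * (2 : ℝ) ^ m := by fun_prop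
  exact hc.measurable

/-! ### Net content and countable intersections of open sets -/

/-- Countability of covers is automatic, as there are only countably many dyadic cubes. -/
lemma le_netContent_iff {p : EuclideanSpace ℝ (Fin d)} {ν : Measure (EuclideanSpace ℝ (Fin d))}
    {η : ℝ} {E : Set (EuclideanSpace ℝ (Fin d))} {a : ℝ≥0∞} :
    a ≤ netContent p ν η E ↔ ∀ C : Set (Set (EuclideanSpace ℝ (Fin d))), C ⊆ dyadicCubes p →
      E ⊆ ⋃₀ C → a ≤ ∑' D : C, ν (D : Set (EuclideanSpace ℝ (Fin d))) ^ η := by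
  simp only [netContent, le_iInf_iff]
  exact ⟨fun h C hC hE => h C ((countable_dyadicCubes p).mono hC) hC hE,
    fun h C _ hC hE => h C hC hE⟩

lemma netContent_mono (p : EuclideanSpace ℝ (Fin d)) (ν : Measure (EuclideanSpace ℝ (Fin d)))
    (η : ℝ) {E F : Set (EuclideanSpace ℝ (Fin d))} (h : E ⊆ F) :
    netContent p ν η E ≤ netContent p ν η F :=
  le_netContent_iff.2 fun C hC hF => le_netContent_iff.1 le_rfl C hC (h.trans hF)

lemma netContent_le_of_mem {p : EuclideanSpace ℝ (Fin d)}
    (ν : Measure (EuclideanSpace ℝ (Fin d))) (η : ℝ) {D : Set (EuclideanSpace ℝ (Fin d))}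
    (hD : D ∈ dyadicCubes p) : netContent p ν η D ≤ ν D ^ η := by
  refine (le_netContent_iff.1 le_rfl {D} (by simpa using hD) (by simp)).trans ?_
  rw [tsum_singleton D (fun K => ν K ^ η)]

/-- The part of the cost of a family `C` of cubes that is spent on cubes meeting `Q`. -/
def localCost (ν : Measure (EuclideanSpace ℝ (Fin d))) (η : ℝ)
    (C : Set (Set (EuclideanSpace ℝ (Fin d)))) (Q : Set (EuclideanSpace ℝ (Fin d))) : ℝ≥0∞ :=
  ∑' K : {K | K ∈ C ∧ (K ∩ Q).Nonempty}, ν (K : Set (EuclideanSpace ℝ (Fin d))) ^ η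

/-- If a family of cubes is too cheap near `Q` to cover `O ⊆ Q`, then it is too cheap
near some much smaller cube well inside `O`: otherwise it could be replaced by a cover of `O`
that costs no more. -/
lemma exists_cubeAt_localCost_lt {p : EuclideanSpace ℝ (Fin d)}
    {ν : Measure (EuclideanSpace ℝ (Fin d))} {η : ℝ}
    {C : Set (Set (EuclideanSpace ℝ (Fin d)))} (hC : C ⊆ dyadicCubes p)
    {Q O : Set (EuclideanSpace ℝ (Fin d))} (hO : IsOpen O) (hOQ : O ⊆ Q)
    (hlt : localCost ν η C Q < netContent p ν η O) (m : ℤ) :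
    ∃ n > m, ∃ x ∈ O, closure (cubeAt p n x) ⊆ O ∧
      localCost ν η C (cubeAt p n x) < ν (cubeAt p n x) ^ η := by
  classical
  by_contra! hcon
  have hex : ∀ x ∈ O, ∃ j : ℕ, closure (cubeAt p (m + 1 + j) x) ⊆ O := fun x hx =>
    exists_closure_cubeAt_subset p hO hx (m + 1)
  choose! ℓ0 hℓ0 using hex
  -- The least admissible level gives the largest cube around `x`, of level above `m`, with closure
  -- in `O`. By maximality two such cubes are equal or disjoint.
  let lev : EuclideanSpace ℝ (Fin d) → ℕ := fun x =>
    if h : ∃ j : ℕ, closure (cubeAt p (m + 1 + j) x) ⊆ O then Nat.find h else 0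
  have hlev : ∀ x ∈ O, closure (cubeAt p (m + 1 + lev x) x) ⊆ O := by
    intro x hx
    have h : ∃ j : ℕ, closure (cubeAt p (m + 1 + j) x) ⊆ O := ⟨_, hℓ0 x hx⟩
    simp only [lev, dif_pos h]
    exact Nat.find_spec h
  have hmin : ∀ x (j : ℕ), closure (cubeAt p (m + 1 + j) x) ⊆ O → lev x ≤ j := by
    intro x j hj
    have h : ∃ j : ℕ, closure (cubeAt p (m + 1 + j) x) ⊆ O := ⟨_, hj⟩
    simp only [lev, dif_pos h]
    exact Nat.find_min' h hj
  have hle : ∀ x ∈ O, ∀ y ∈ O, ∀ z ∈ cubeAt p (m + 1 + lev x) x, z ∈ cubeAt p (m + 1 + lev y) y →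
      lev x ≤ lev y → cubeAt p (m + 1 + lev x) x = cubeAt p (m + 1 + lev y) y := by
    intro x hx y hy z hzx hzy hxy
    have h1 : y ∈ cubeAt p (m + 1 + lev x) x :=
      dyadicCube_subset_of_le (by omega) hzx hzy (mem_cubeAt p _ y)
    have h2 : lev y ≤ lev x := hmin y _ (by rw [← cubeAt_congr h1]; exact hlev x hx)
    rw [cubeAt_congr h1, le_antisymm hxy h2]
  have heq : ∀ x ∈ O, ∀ y ∈ O, ∀ z ∈ cubeAt p (m + 1 + lev x) x, z ∈ cubeAt p (m + 1 + lev y) y →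
      cubeAt p (m + 1 + lev x) x = cubeAt p (m + 1 + lev y) y := by
    intro x hx y hy z hzx hzy
    rcases le_total (lev x) (lev y) with h | h
    · exact hle x hx y hy z hzx hzy h
    · exact (hle y hy x hx z hzy hzx h).symm
  -- Exchange: each maximal cube `R` that no member of `C` contains replaces the members `T R` of
  -- `C` that meet it. These lie inside `R` and, by `hcon`, cost at least as much as `R`. The
  -- members in `C1` are kept.
  let F : Set (Set (EuclideanSpace ℝ (Fin d))) :=
    {R | (∃ x ∈ O, R = cubeAt p (m + 1 + lev x) x) ∧ ∀ K ∈ C, ¬ R ⊆ K}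
  let C1 : Set (Set (EuclideanSpace ℝ (Fin d))) :=
    {K | (K ∈ C ∧ (K ∩ Q).Nonempty) ∧ ∀ R ∈ F, ¬ (K ∩ R).Nonempty}
  let T : Set (EuclideanSpace ℝ (Fin d)) → Set (Set (EuclideanSpace ℝ (Fin d))) :=
    fun R => {K | K ∈ C ∧ (K ∩ R).Nonempty}
  have hFD : F ⊆ dyadicCubes p := by
    rintro R ⟨⟨x, -, rfl⟩, -⟩
    exact cubeAt_mem p _ x
  have hsub : ∀ R ∈ F, ∀ K ∈ T R, K ⊆ R := by
    rintro R hR K ⟨hK, z, hzK, hzR⟩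
    exact (subset_or_subset_of_mem (hC hK) (hFD hR) hzK hzR).resolve_right (hR.2 K hK)
  have hcover : O ⊆ ⋃₀ (F ∪ C1) := by
    intro x hx
    by_cases hF : cubeAt p (m + 1 + lev x) x ∈ F
    · exact ⟨_, Or.inl hF, mem_cubeAt p _ x⟩
    · have h : ∃ K ∈ C, cubeAt p (m + 1 + lev x) x ⊆ K := by
        by_contra! hno
        exact hF ⟨⟨x, hx, rfl⟩, hno⟩
      obtain ⟨K, hK, hRK⟩ := h
      have hxK : x ∈ K := hRK (mem_cubeAt p _ x)
      refine ⟨K, Or.inr ⟨⟨hK, x, hxK, hOQ hx⟩, fun R hR hne => ?_⟩, hxK⟩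
      have hKR := hsub R hR K ⟨hK, hne⟩
      obtain ⟨⟨y, hy, rfl⟩, hRC⟩ := hR
      exact hRC K hK (heq x hx y hy x (mem_cubeAt p _ x) (hKR hxK) ▸ hRK)
  have hdisjF : F.PairwiseDisjoint T := by
    intro R hR S hS hne
    refine Set.disjoint_left.2 fun K hKR hKS => hne ?_
    obtain ⟨z, hz⟩ := nonempty_of_mem_dyadicCubes (hC hKR.1)
    have h1 := hsub R hR K hKR hz
    have h2 := hsub S hS K hKS hz
    obtain ⟨⟨x, hx, rfl⟩, -⟩ := hR
    obtain ⟨⟨y, hy, rfl⟩, -⟩ := hS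
    exact heq x hx y hy z h1 h2
  have hdisj : Disjoint (⋃ R ∈ F, T R) C1 := by
    refine Set.disjoint_left.2 fun K hK hK1 => ?_
    simp only [Set.mem_iUnion] at hK
    obtain ⟨R, hR, hKR⟩ := hK
    exact hK1.2 R hR hKR.2
  refine absurd hlt (not_lt.2 ?_)
  calc netContent p ν η O
      ≤ ∑' K : ↑(F ∪ C1), ν (K : Set (EuclideanSpace ℝ (Fin d))) ^ η :=
        le_netContent_iff.1 le_rfl _ (Set.union_subset hFD fun K hK => hC hK.1.1) hcover
    _ ≤ (∑' R : F, ν (R : Set (EuclideanSpace ℝ (Fin d))) ^ η) +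
          ∑' K : C1, ν (K : Set (EuclideanSpace ℝ (Fin d))) ^ η :=
        ENNReal.tsum_union_le (fun K => ν K ^ η) F C1
    _ ≤ (∑' R : F, localCost ν η C R) +
          ∑' K : C1, ν (K : Set (EuclideanSpace ℝ (Fin d))) ^ η := by
        gcongr with R
        obtain ⟨R, ⟨x, hx, rfl⟩, -⟩ := R
        exact hcon _ (by omega) x hx (hlev x hx)
    _ = (∑' K : ↑(⋃ R ∈ F, T R), ν (K : Set (EuclideanSpace ℝ (Fin d))) ^ η) +
          ∑' K : C1, ν (K : Set (EuclideanSpace ℝ (Fin d))) ^ η := by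
        rw [ENNReal.tsum_biUnion' (f := fun K => ν K ^ η) hdisjF]
        rfl
    _ = ∑' K : ↑((⋃ R ∈ F, T R) ∪ C1), ν (K : Set (EuclideanSpace ℝ (Fin d))) ^ η :=
        (ENNReal.summable.tsum_union_disjoint (f := fun K => ν K ^ η) hdisj
          ENNReal.summable).symm
    _ ≤ localCost ν η C Q := by
        refine ENNReal.tsum_mono_subtype (fun K => ν K ^ η) (Set.union_subset ?_ fun K hK => hK.1)
        refine Set.iUnion₂_subset fun R hR K hK => ⟨hK.1, ?_⟩
        obtain ⟨z, hzK, hzR⟩ := hK.2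
        obtain ⟨⟨x, hx, rfl⟩, -⟩ := hR
        exact ⟨z, hzK, hOQ (hlev x hx (subset_closure hzR))⟩

/-- Full net content passes to countable intersections of open sets. -/
theorem le_netContent_iInter {p : EuclideanSpace ℝ (Fin d)}
    {ν : Measure (EuclideanSpace ℝ (Fin d))} {η : ℝ} (hη : 0 ≤ η)
    {U : ℕ → Set (EuclideanSpace ℝ (Fin d))} (hU : ∀ N, IsOpen (U N))
    (hfull : ∀ N, ∀ Q ∈ dyadicCubes p, ν Q ^ η ≤ netContent p ν η (U N ∩ interior Q))
    {D : Set (EuclideanSpace ℝ (Fin d))} (hD : D ∈ dyadicCubes p) :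
    ν D ^ η ≤ netContent p ν η ((⋂ N, U N) ∩ D) := by
  refine le_netContent_iff.2 fun C hC hcov => ?_
  by_contra! hlt
  -- The states of the recursion: cubes near which `C` is too cheap.
  let S := {q : ℤ × EuclideanSpace ℝ (Fin d) //
    localCost ν η C (cubeAt p q.1 q.2) < ν (cubeAt p q.1 q.2) ^ η}
  have hstep : ∀ (N : ℕ) (q : S), ∃ q' : S, q.1.1 < q'.1.1 ∧
      closure (cubeAt p q'.1.1 q'.1.2) ⊆ U N ∩ interior (cubeAt p q.1.1 q.1.2) := by
    rintro N ⟨⟨n, x⟩, hq⟩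
    obtain ⟨n', hn', x', -, hcl, hx'⟩ := exists_cubeAt_localCost_lt hC
      ((hU N).inter isOpen_interior) (Set.inter_subset_right.trans interior_subset)
      (hq.trans_le (hfull N _ (cubeAt_mem p n x))) n
    exact ⟨⟨(n', x'), hx'⟩, hn', hcl⟩
  choose nxt hlev hcl using hstep
  obtain ⟨m, k, rfl⟩ := hD
  obtain ⟨x0, hx0⟩ := dyadicCube_nonempty p m k
  change ν (dyadicCube p m k) ^ η > _ at hlt
  rw [cubeAt_eq_of_mem hx0] at hlt
  have h0 : localCost ν η C (cubeAt p m x0) < ν (cubeAt p m x0) ^ η :=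
    (ENNReal.tsum_mono_subtype (fun K => ν K ^ η) fun K hK => hK.1).trans_lt hlt
  let q : ℕ → S := fun n => Nat.rec ⟨(m, x0), h0⟩ nxt n
  have hq : ∀ N, q (N + 1) = nxt N (q N) := fun N => rfl
  let R : ℕ → Set (EuclideanSpace ℝ (Fin d)) := fun N => cubeAt p (q N).1.1 (q N).1.2
  have hR : ∀ N, closure (R (N + 1)) ⊆ U N ∩ interior (R N) := fun N => hcl N (q N)
  have hlevel : ∀ N : ℕ, m + N ≤ (q N).1.1 := by
    intro N
    induction N with
    | zero => simp [q]
    | succ N ih =>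
      have := hlev N (q N)
      rw [← hq] at this
      push_cast
      omega
  obtain ⟨x, hx⟩ := IsCompact.nonempty_iInter_of_sequence_nonempty_isCompact_isClosed
    (fun N => closure (R (N + 1)))
    (fun N => (hR (N + 1)).trans ((Set.inter_subset_right.trans interior_subset).trans
      subset_closure))
    (fun N => ⟨_, subset_closure (mem_cubeAt p _ _)⟩)
    (isCompact_closure_cubeAt p _ _) (fun N => isClosed_closure)
  rw [Set.mem_iInter] at hx
  have hxR : ∀ N, x ∈ R N := fun N => interior_subset (hR N (hx N)).2
  obtain ⟨K, hK, hxK⟩ := hcov (show x ∈ (⋂ N, U N) ∩ dyadicCube p m k from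
    ⟨Set.mem_iInter.2 fun N => (hR N (hx N)).1, by
      rw [cubeAt_eq_of_mem hx0]
      exact hxR 0⟩)
  -- Once the level of `R N` reaches that of `K`, the cube `R N` lies in `K`, and `K` alone
  -- contradicts cheapness near `R N`.
  obtain ⟨n, l, hKn⟩ := hC hK
  obtain ⟨N, hN⟩ : ∃ N : ℕ, n ≤ m + N := ⟨(n - m).toNat, by omega⟩
  have hsub : R N ⊆ K := by
    rw [hKn] at hxK ⊢
    exact dyadicCube_subset_of_le (hN.trans (hlevel N)) hxK (hxR N)
  refine absurd (q N).2 (not_lt.2 ?_)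
  calc ν (R N) ^ η ≤ ν K ^ η := by gcongr
    _ ≤ localCost ν η C (R N) :=
      ENNReal.le_tsum (f := fun K : {K | K ∈ C ∧ (K ∩ R N).Nonempty} =>
        ν (K : Set (EuclideanSpace ℝ (Fin d))) ^ η) ⟨K, hK, x, hxK, hxR N⟩

/-! ### Mass distribution principle for the net content -/

lemma rpow_one_sub_mul_rpow {η : ℝ} (hη : 0 ≤ η) (hη1 : η ≤ 1) (a : ℝ≥0∞) :
    a ^ (1 - η) * a ^ η = a := by
  rw [← ENNReal.rpow_add_of_nonneg _ _ (by linarith) hη, sub_add_cancel, ENNReal.rpow_one]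

lemma le_rpow_one_sub_mul_rpow {η : ℝ} (hη : 0 ≤ η) (hη1 : η ≤ 1) {a b : ℝ≥0∞} (h : a ≤ b) :
    a ≤ b ^ (1 - η) * a ^ η := by
  conv_lhs => rw [← rpow_one_sub_mul_rpow hη hη1 a]
  gcongr

/-- In essence `a / b ≤ (a / b) ^ η` for a fraction at most one. It controls the share of mass that
a subcube receives. -/
lemma rpow_mul_div_le {η : ℝ} (hη : 0 ≤ η) (hη1 : η ≤ 1) {a b : ℝ≥0∞} (h : a ≤ b) :
    b ^ η * (a / b) ≤ a ^ η := by
  rw [← mul_div_assoc]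
  refine ENNReal.div_le_of_le_mul ?_
  calc b ^ η * a ≤ b ^ η * (b ^ (1 - η) * a ^ η) := by
        gcongr
        exact le_rpow_one_sub_mul_rpow hη hη1 h
    _ = a ^ η * (b ^ (1 - η) * b ^ η) := by ring
    _ = a ^ η * b := by rw [rpow_one_sub_mul_rpow hη hη1]

open Classical in
/-- The number of indices `n ∈ I` such that `x n ∈ B`. -/
def hitCount {ι E : Type*} (I : Finset ι) (x : ι → E) (B : Set E) : ℕ :=
  (I.filter fun n => x n ∈ B).card

/-- Points `x n` of a cube `Q` whose surrounding level `m` cubes lie in `U` force a lower bound for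
the net content of `U ∩ interior Q`, if they are not too concentrated on any cube. -/
theorem card_le_mul_netContent {ι : Type*} {p : EuclideanSpace ℝ (Fin d)}
    {ν : Measure (EuclideanSpace ℝ (Fin d))} [IsFiniteMeasure ν] {η : ℝ} (hη : 0 ≤ η)
    (hη1 : η ≤ 1) {m₀ m : ℤ} (hm : m₀ ≤ m) {k₀ : Fin d → ℤ}
    (hbd : ν (frontier (dyadicCube p m₀ k₀)) = 0) {U : Set (EuclideanSpace ℝ (Fin d))}
    (J : Finset ι) (x : ι → EuclideanSpace ℝ (Fin d)) (hxQ : ∀ n ∈ J, x n ∈ dyadicCube p m₀ k₀)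
    (hU : ∀ n ∈ J, cubeAt p m (x n) ⊆ U) {β q a : ℝ≥0∞} (hβ0 : β ≠ 0)
    (ha : a ≠ ⊤)
    (hβ : ∀ n ∈ J, β ≤ ν (cubeAt p m (x n)))
    (hcount : ∀ ℓ, m₀ ≤ ℓ → ℓ ≤ m → ∀ k, β ≤ ν (dyadicCube p ℓ k) →
      (hitCount J x (dyadicCube p ℓ k) : ℝ≥0∞) ≤ a * max (ν (dyadicCube p ℓ k)) q)
    (hq : q ≤ ν (dyadicCube p m₀ k₀) ^ (1 - η) * β ^ η) :
    (J.card : ℝ≥0∞) ≤ a * ν (dyadicCube p m₀ k₀) ^ (1 - η) *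
      netContent p ν η (U ∩ interior (dyadicCube p m₀ k₀)) := by
  classical
  set Q := dyadicCube p m₀ k₀ with hQ
  have hRQ : ∀ n ∈ J, cubeAt p m (x n) ⊆ Q := fun n hn =>
    dyadicCube_subset_of_le hm (hxQ n hn) (mem_cubeAt p m _)
  have hR0 : ∀ n ∈ J, ν (cubeAt p m (x n)) ≠ 0 := fun n hn =>
    ((pos_iff_ne_zero.2 hβ0).trans_le (hβ n hn)).ne'
  have hcoarse : ∀ ℓ, m₀ ≤ ℓ → ℓ ≤ m → ∀ k, ∀ n₀ ∈ J, x n₀ ∈ dyadicCube p ℓ k →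
      (hitCount J x (dyadicCube p ℓ k) : ℝ≥0∞) ≤
        a * ν Q ^ (1 - η) * ν (dyadicCube p ℓ k) ^ η := by
    intro ℓ h1 h2 k n₀ hn₀ hx
    have hβK : β ≤ ν (dyadicCube p ℓ k) := (hβ n₀ hn₀).trans
      (measure_mono (dyadicCube_subset_of_le h2 hx (mem_cubeAt p m _)))
    refine (hcount ℓ h1 h2 k hβK).trans ?_
    rw [mul_assoc]
    gcongr
    refine max_le (le_rpow_one_sub_mul_rpow hη hη1 (measure_mono
      (dyadicCube_subset_of_le h1 (hxQ n₀ hn₀) hx))) (hq.trans ?_)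
    gcongr
  -- The sum is the mass of `K` when each `n` spreads a unit mass over its cube proportionally to
  -- `ν`. For levels from `m₀` to `m` it is at most the number of points in `K`; a coarser `K`
  -- inherits the bound of `Q`; a finer one takes a proportional share of a single cube of level
  -- `m`.
  have hcost : ∀ K ∈ dyadicCubes p, ∑ n ∈ J, ν (K ∩ cubeAt p m (x n)) / ν (cubeAt p m (x n)) ≤
      a * ν Q ^ (1 - η) * ν K ^ η := by
    rintro K ⟨ℓ, k, rfl⟩
    change ∑ n ∈ J, ν (dyadicCube p ℓ k ∩ _) / _ ≤ _ * ν (dyadicCube p ℓ k) ^ η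
    rcases le_or_gt ℓ m with hℓ | hℓ
    · have h1 : ∑ n ∈ J, ν (dyadicCube p ℓ k ∩ cubeAt p m (x n)) / ν (cubeAt p m (x n)) ≤
          (hitCount J x (dyadicCube p ℓ k) : ℝ≥0∞) := by
        rw [hitCount, Finset.card_filter, Nat.cast_sum]
        refine Finset.sum_le_sum fun n _ => ?_
        split_ifs with hn
        · rw [Nat.cast_one]
          exact ENNReal.div_le_of_le_mul (by
            rw [one_mul]; exact measure_mono Set.inter_subset_right)
        · have : dyadicCube p ℓ k ∩ cubeAt p m (x n) = ∅ := by
            refine Set.eq_empty_iff_forall_notMem.2 fun z hz => hn ?_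
            exact dyadicCube_subset_of_le hℓ hz.1 hz.2 (mem_cubeAt p m _)
          simp [this]
      refine h1.trans ?_
      rcases (J.filter fun n => x n ∈ dyadicCube p ℓ k).eq_empty_or_nonempty with h0 | ⟨n₀, h0⟩
      · simp [hitCount, h0]
      rw [Finset.mem_filter] at h0
      rcases le_total m₀ ℓ with hℓ' | hℓ'
      · exact hcoarse ℓ hℓ' hℓ k n₀ h0.1 h0.2
      · have h2 := hcoarse m₀ le_rfl hm k₀ n₀ h0.1 (hxQ n₀ h0.1)
        rw [hitCount, Finset.filter_true_of_mem hxQ] at h2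
        refine (Nat.cast_le.2 (Finset.card_filter_le _ _)).trans (h2.trans ?_)
        gcongr
        exact dyadicCube_subset_of_le hℓ' h0.2 (hxQ n₀ h0.1)
    · by_cases hne : ∃ n₀ ∈ J, (dyadicCube p ℓ k ∩ cubeAt p m (x n₀)).Nonempty
      · obtain ⟨n₀, hn₀, z, hzK, hzR⟩ := hne
        have hKR : dyadicCube p ℓ k ⊆ cubeAt p m (x n₀) :=
          dyadicCube_subset_of_le hℓ.le hzR hzK
        calc ∑ n ∈ J, ν (dyadicCube p ℓ k ∩ cubeAt p m (x n)) / ν (cubeAt p m (x n))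
            ≤ ∑ n ∈ J, if x n ∈ cubeAt p m (x n₀) then
                ν (dyadicCube p ℓ k) / ν (cubeAt p m (x n₀)) else 0 := by
              refine Finset.sum_le_sum fun n _ => ?_
              split_ifs with hn
              · rw [← cubeAt_congr hn]
                gcongr
                exact Set.inter_subset_left
              · have : dyadicCube p ℓ k ∩ cubeAt p m (x n) = ∅ := by
                  refine Set.eq_empty_iff_forall_notMem.2 fun y hy => hn ?_
                  exact dyadicCube_subset_of_le le_rfl (hKR hy.1) hy.2 (mem_cubeAt p m _)
                simp [this]
          _ = (hitCount J x (cubeAt p m (x n₀)) : ℝ≥0∞) *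
                (ν (dyadicCube p ℓ k) / ν (cubeAt p m (x n₀))) := by
              rw [hitCount, ← Finset.sum_filter, Finset.sum_const, nsmul_eq_mul]
          _ ≤ a * ν Q ^ (1 - η) * ν (cubeAt p m (x n₀)) ^ η *
                (ν (dyadicCube p ℓ k) / ν (cubeAt p m (x n₀))) := by
              gcongr
              exact hcoarse m hm le_rfl _ n₀ hn₀ (mem_cubeAt p m _)
          _ ≤ a * ν Q ^ (1 - η) * ν (dyadicCube p ℓ k) ^ η := by
              rw [mul_assoc (a * ν Q ^ (1 - η))]
              gcongr
              exact rpow_mul_div_le hη hη1 (measure_mono hKR)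
      · push Not at hne
        rw [Finset.sum_eq_zero fun n hn => by rw [hne n hn, measure_empty, ENNReal.zero_div]]
        exact zero_le
  have hmain : ∀ C ⊆ dyadicCubes p, U ∩ interior Q ⊆ ⋃₀ C →
      (J.card : ℝ≥0∞) ≤ a * ν Q ^ (1 - η) *
        ∑' D : C, ν (D : Set (EuclideanSpace ℝ (Fin d))) ^ η := by
    intro C hC hcov
    have : Countable C := ((countable_dyadicCubes p).mono hC).to_subtype
    have hone : ∀ n ∈ J, (1 : ℝ≥0∞) ≤
        ∑' K : C, ν ((K : Set (EuclideanSpace ℝ (Fin d))) ∩ cubeAt p m (x n)) /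
          ν (cubeAt p m (x n)) := by
      intro n hn
      simp only [div_eq_mul_inv]
      rw [ENNReal.tsum_mul_right, ← div_eq_mul_inv,
        ENNReal.le_div_iff_mul_le (Or.inl (hR0 n hn)) (Or.inl (measure_ne_top _ _)), one_mul]
      -- The cover can miss only the part of the cube in the frontier of `Q`, which is null.
      calc ν (cubeAt p m (x n))
          ≤ ν ((⋃ K : C, (K : Set (EuclideanSpace ℝ (Fin d))) ∩ cubeAt p m (x n)) ∪
              frontier Q) := by
            refine measure_mono fun z hz => ?_
            by_cases hzi : z ∈ interior Q
            · obtain ⟨K, hK, hzK⟩ := hcov ⟨hU n hn hz, hzi⟩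
              exact Or.inl (Set.mem_iUnion.2 ⟨⟨K, hK⟩, hzK, hz⟩)
            · exact Or.inr ⟨subset_closure (hRQ n hn hz), hzi⟩
        _ ≤ ν (⋃ K : C, (K : Set (EuclideanSpace ℝ (Fin d))) ∩ cubeAt p m (x n)) := by
            refine (measure_union_le _ _).trans ?_
            rw [hbd, add_zero]
        _ ≤ _ := measure_iUnion_le _
    calc (J.card : ℝ≥0∞) = ∑ n ∈ J, 1 := by simp
      _ ≤ ∑ n ∈ J, ∑' K : C, ν ((K : Set (EuclideanSpace ℝ (Fin d))) ∩ cubeAt p m (x n)) /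
          ν (cubeAt p m (x n)) := Finset.sum_le_sum hone
      _ = ∑' K : C, ∑ n ∈ J, ν ((K : Set (EuclideanSpace ℝ (Fin d))) ∩ cubeAt p m (x n)) /
          ν (cubeAt p m (x n)) := (Summable.tsum_finsetSum fun _ _ => ENNReal.summable).symm
      _ ≤ ∑' K : C, a * ν Q ^ (1 - η) * ν (K : Set (EuclideanSpace ℝ (Fin d))) ^ η :=
          ENNReal.tsum_le_tsum fun K => hcost K (hC K.2)
      _ = _ := ENNReal.tsum_mul_left
  have htop : a * ν Q ^ (1 - η) ≠ ⊤ := ENNReal.mul_ne_top ha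
    (ENNReal.rpow_ne_top_of_nonneg (by linarith) (measure_ne_top _ _))
  have hfin : netContent p ν η (U ∩ interior Q) ≠ ⊤ :=
    (((netContent_mono p ν η (Set.inter_subset_right.trans interior_subset)).trans
      (netContent_le_of_mem ν η (dyadicCube_mem p m₀ k₀))).trans_lt
        (ENNReal.rpow_lt_top_of_nonneg hη (measure_ne_top _ _))).ne
  have hdiv : (J.card : ℝ≥0∞) / (a * ν Q ^ (1 - η)) ≤ netContent p ν η (U ∩ interior Q) :=
    le_netContent_iff.2 fun C hC hcov => ENNReal.div_le_of_le_mul' (hmain C hC hcov)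
  exact ((ENNReal.div_le_iff_le_mul (Or.inr hfin) (Or.inl htop)).1 hdiv).trans_eq (mul_comm _ _)

/-! ### Chernoff bounds and overfull cubes -/

/-- The exponent in the upper Chernoff bound for sums of independent indicators. -/
def chernoffRate (ε : ℝ) : ℝ := (1 + ε) * Real.log (1 + ε) - ε

lemma chernoffRate_pos {ε : ℝ} (hε : 0 < ε) : 0 < chernoffRate ε := by
  have h1 : 1 + ε ≠ 0 := by positivity
  have h : Real.log (1 + ε)⁻¹ < (1 + ε)⁻¹ - 1 :=
    Real.log_lt_sub_one_of_pos (by positivity) (by simpa using hε.ne')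
  rw [Real.log_inv] at h
  have h2 : (1 + ε) * (-Real.log (1 + ε)) < (1 + ε) * ((1 + ε)⁻¹ - 1) :=
    mul_lt_mul_of_pos_left h (by positivity)
  rw [mul_sub, mul_inv_cancel₀ h1] at h2
  unfold chernoffRate
  linarith

/-- Chernoff bound for the number of independent points of law `μ` that fall into `B`. -/
theorem measure_le_card_filter_le {E : Type*} [MeasurableSpace E] {μ : Measure E}
    [IsProbabilityMeasure μ] {Ω : Type*} [MeasurableSpace Ω] {P : Measure Ω}
    [IsProbabilityMeasure P] {X : ℕ → Ω → E} (hX : ∀ n, Measurable (X n))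
    (hindep : iIndepFun X P) (hlaw : ∀ n, P.map (X n) = μ) {B : Set E} (hB : MeasurableSet B)
    (I : Finset ℕ) {a ε : ℝ} (hε : 0 < ε) (ha : μ.real B ≤ a) :
    P {ω | (1 + ε) * I.card * a ≤ (hitCount I (fun n => X n ω) B : ℝ)} ≤
      ENNReal.ofReal (Real.exp (-(chernoffRate ε * I.card * a))) := by
  have hε1 : 0 < 1 + ε := by linarith
  -- The optimal Chernoff parameter: `exp (l * f)` is `1 + ε * f` for the indicator `f`, so the
  -- moment generating function is `1 + ε μ(B) ≤ exp (ε a)`.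
  set l := Real.log (1 + ε) with hl
  have hl0 : 0 ≤ l := Real.log_nonneg (by linarith)
  have hexp : Real.exp l = 1 + ε := Real.exp_log hε1
  let f : E → ℝ := B.indicator fun _ => 1
  have hf : Measurable f := measurable_const.indicator hB
  let Y : ℕ → Ω → ℝ := fun n => f ∘ X n
  have hY : ∀ n, Measurable (Y n) := fun n => hf.comp (hX n)
  have hYind : iIndepFun Y P := hindep.comp (fun _ => f) fun _ => hf
  have hfe : ∀ x, Real.exp (l * f x) = 1 + ε * f x := by
    intro x
    by_cases hx : x ∈ B
    · simp [f, hx, hexp]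
    · simp [f, hx]
  have hfint : Integrable (fun x => 1 + ε * f x) μ :=
    (integrable_const _).add (((integrable_const _).indicator hB).const_mul _)
  have hint : ∀ n, Integrable (fun ω => Real.exp (l * Y n ω)) P := by
    intro n
    have h : Integrable (fun x => 1 + ε * f x) (P.map (X n)) := by rwa [hlaw n]
    refine (h.comp_measurable (hX n)).congr (ae_of_all _ fun ω => ?_)
    exact (hfe (X n ω)).symm
  have hmgf : ∀ n, mgf (Y n) P l ≤ Real.exp (ε * a) := by
    intro n
    have h1 : mgf (Y n) P l = ∫ x, 1 + ε * f x ∂μ := by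
      have hm : Measurable fun x => 1 + ε * f x := (hf.const_mul ε).const_add 1
      rw [← hlaw n, integral_map (hX n).aemeasurable hm.aestronglyMeasurable]
      exact integral_congr_ae (ae_of_all _ fun ω => hfe (X n ω))
    have h2 : ∫ x, 1 + ε * f x ∂μ = 1 + ε * μ.real B := by
      rw [integral_add (integrable_const _) (((integrable_const _).indicator hB).const_mul _),
        integral_const_mul, integral_indicator hB]
      simp
    rw [h1, h2]
    refine le_trans ?_ (Real.add_one_le_exp _)
    nlinarith
  have hsum : ∀ ω, (∑ n ∈ I, Y n) ω = (hitCount I (fun n => X n ω) B : ℝ) := by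
    intro ω
    rw [hitCount, Finset.sum_apply, Finset.card_filter, Nat.cast_sum]
    refine Finset.sum_congr rfl fun n _ => ?_
    by_cases hx : X n ω ∈ B <;> simp [Y, f, hx]
  have hcher := measure_ge_le_exp_mul_mgf (μ := P) (X := ∑ n ∈ I, Y n) ((1 + ε) * I.card * a) hl0
    (hYind.integrable_exp_mul_sum hY fun n _ => hint n)
  simp only [hsum] at hcher
  rw [hYind.mgf_sum hY] at hcher
  have hprod : ∏ n ∈ I, mgf (Y n) P l ≤ Real.exp (ε * a) ^ I.card :=
    (Finset.prod_le_prod (fun n _ => mgf_nonneg) fun n _ => hmgf n).trans (by simp)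
  rw [← ENNReal.ofReal_toReal (measure_ne_top P _)]
  refine ENNReal.ofReal_le_ofReal (hcher.trans ?_)
  refine (mul_le_mul_of_nonneg_left hprod (Real.exp_pos _).le).trans_eq ?_
  rw [← Real.exp_nat_mul, ← Real.exp_add]
  congr 1
  rw [chernoffRate, ← hl]
  ring

lemma finite_setOf_le_measure_dyadicCube (p : EuclideanSpace ℝ (Fin d))
    (ν : Measure (EuclideanSpace ℝ (Fin d))) [IsFiniteMeasure ν] (m : ℤ) {β : ℝ≥0∞} (hβ : 0 < β) :
    {k | β ≤ ν (dyadicCube p m k)}.Finite :=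
  Measure.finite_const_le_meas_of_disjoint_iUnion ν hβ (fun k => measurableSet_gridCube p _ k)
    (disjoint_gridCube p (by positivity)) (measure_ne_top _ _)

lemma card_mul_le_of_le_measure_dyadicCube {p : EuclideanSpace ℝ (Fin d)}
    {ν : Measure (EuclideanSpace ℝ (Fin d))} {m : ℤ} {β : ℝ≥0∞} {S : Finset (Fin d → ℤ)}
    (hS : ∀ k ∈ S, β ≤ ν (dyadicCube p m k)) : S.card * β ≤ ν Set.univ := by
  calc S.card * β = ∑ k ∈ S, β := by simp
    _ ≤ ∑ k ∈ S, ν (dyadicCube p m k) := Finset.sum_le_sum hS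
    _ = ν (⋃ k ∈ S, dyadicCube p m k) :=
      (measure_biUnion_finset (fun k _ l _ h => disjoint_gridCube p (by positivity) h)
        fun k _ => measurableSet_gridCube p _ k).symm
    _ ≤ ν Set.univ := measure_mono (Set.subset_univ _)

lemma tendsto_two_rpow_natCast_mul {γ : ℝ} (hγ : 0 < γ) :
    Tendsto (fun m : ℕ => (2 : ℝ) ^ ((m : ℝ) * γ)) atTop atTop := by
  have h : Tendsto (fun m : ℕ => ((2 : ℝ) ^ γ) ^ m) atTop atTop :=
    tendsto_pow_atTop_atTop_of_one_lt (Real.one_lt_rpow (by norm_num) hγ)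
  refine h.congr fun m => ?_
  rw [← Real.rpow_natCast, ← Real.rpow_mul (by norm_num), mul_comm]

lemma tendsto_two_rpow_neg_natCast_mul {γ : ℝ} (hγ : 0 < γ) :
    Tendsto (fun m : ℕ => (2 : ℝ) ^ (-((m : ℝ) * γ))) atTop (𝓝 0) := by
  refine (tendsto_inv_atTop_zero.comp (tendsto_two_rpow_natCast_mul hγ)).congr fun m => ?_
  rw [Function.comp_apply, Real.rpow_neg (by norm_num)]

/-- With `y = 2^(mγ)` this is `y^(t/γ) * exp (-c y)`. It lets the failure probability of one cube
beat the exponential number of cubes. -/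
lemma tendsto_two_rpow_mul_exp_neg {t γ c : ℝ} (hγ : 0 < γ) (hc : 0 < c) :
    Tendsto (fun m : ℕ => (2 : ℝ) ^ ((m : ℝ) * t) * Real.exp (-(c * 2 ^ ((m : ℝ) * γ))))
      atTop (𝓝 0) := by
  have h := (tendsto_rpow_mul_exp_neg_mul_atTop_nhds_zero (t / γ) c hc).comp
    (tendsto_two_rpow_natCast_mul hγ)
  refine h.congr fun m => ?_
  simp only [Function.comp_apply]
  rw [← Real.rpow_mul (by norm_num), neg_mul, show (m : ℝ) * γ * (t / γ) = m * t by field_simp]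

/-- If the probability of `F m` tends to zero, then almost surely infinitely many `F m` fail. -/
lemma ae_frequently_notMem {Ω : Type*} [MeasurableSpace Ω] {P : Measure Ω} {F : ℕ → Set Ω}
    (hF : Tendsto (fun m => P (F m)) atTop (𝓝 0)) : ∀ᵐ ω ∂P, ∃ᶠ m in atTop, ω ∉ F m := by
  have h : ∀ N : ℕ, ∀ᵐ ω ∂P, ω ∉ ⋂ m ≥ N, F m := by
    intro N
    rw [← measure_eq_zero_iff_ae_notMem]
    refine le_antisymm (ge_of_tendsto hF ?_) zero_le
    filter_upwards [eventually_ge_atTop N] with m hm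
    exact measure_mono (Set.biInter_subset_of_mem hm)
  filter_upwards [ae_all_iff.2 h] with ω hω
  rw [frequently_atTop]
  intro N
  have := hω N
  simp only [Set.mem_iInter, not_forall] at this
  obtain ⟨m, hm, hmF⟩ := this
  exact ⟨m, hm, hmF⟩

section

variable {μ : Measure (EuclideanSpace ℝ (Fin d))} [IsProbabilityMeasure μ]
  {Ω : Type*} [MeasurableSpace Ω] {P : Measure Ω} [IsProbabilityMeasure P]
  {X : ℕ → Ω → EuclideanSpace ℝ (Fin d)}

/-- With high probability no cube of levels between `m₀` and `m` that is not too light attracts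
many more points than expected. -/
theorem tendsto_measure_exists_overfull (hX : ∀ n, Measurable (X n))
    (hindep : iIndepFun X P) (hlaw : ∀ n, P.map (X n) = μ)
    (p : EuclideanSpace ℝ (Fin d)) {A : Set (EuclideanSpace ℝ (Fin d))} (hA : MeasurableSet A)
    (m₀ : ℤ) {t κ γ c ε : ℝ} (hκ : κ < γ) (hc : 0 < c) (hε : 0 < ε) {I : ℕ → Finset ℕ}
    (hI : ∀ᶠ m : ℕ in atTop, c * 2 ^ ((m : ℝ) * γ) ≤ (I m).card) :
    Tendsto (fun m : ℕ => P {ω | ∃ ℓ : ℤ, m₀ ≤ ℓ ∧ ℓ ≤ m ∧ ∃ k,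
      ENNReal.ofReal (2 ^ (-((m : ℝ) * t))) ≤ μ.restrict A (dyadicCube p ℓ k) ∧
      (1 + ε) * (I m).card * max ((μ.restrict A).real (dyadicCube p ℓ k)) (2 ^ (-((m : ℝ) * κ))) ≤
        (hitCount (I m) (fun n => X n ω) (A ∩ dyadicCube p ℓ k) : ℝ)}) atTop (𝓝 0) := by
  set ν := μ.restrict A with hν
  set c' := chernoffRate ε * c
  have hc' : 0 < c' := mul_pos (chernoffRate_pos hε) hc
  -- The union bound is the number of levels times `2^(mt)` times one failure probability. Moving a
  -- factor `2^m` makes both factors tend to zero.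
  have hlim : Tendsto (fun m : ℕ => ENNReal.ofReal ((m + 1 - m₀ : ℝ) / 2 ^ m) *
      ENNReal.ofReal (2 ^ ((m : ℝ) * (t + 1)) * Real.exp (-(c' * 2 ^ ((m : ℝ) * (γ - κ))))))
      atTop (𝓝 0) := by
    have h1 : Tendsto (fun m : ℕ => (m + 1 - m₀ : ℝ) / 2 ^ m) atTop (𝓝 0) := by
      have h := ((tendsto_pow_const_div_const_pow_of_one_lt 1 (r := (2 : ℝ)) (by norm_num)).add
        ((tendsto_pow_const_div_const_pow_of_one_lt 0 (r := (2 : ℝ)) (by norm_num)).const_mul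
          (1 - m₀ : ℝ)))
      simp only [mul_zero, add_zero] at h
      refine h.congr fun m => ?_
      field_simp
      ring
    have h2 := tendsto_two_rpow_mul_exp_neg (t := t + 1) (sub_pos.2 hκ) hc'
    have h := (ENNReal.tendsto_ofReal h1)
    have h' := (ENNReal.tendsto_ofReal h2)
    rw [ENNReal.ofReal_zero] at h h'
    simpa using ENNReal.Tendsto.mul h (Or.inr ENNReal.zero_ne_top) h'
      (Or.inr ENNReal.zero_ne_top)
  refine tendsto_of_tendsto_of_tendsto_of_le_of_le' tendsto_const_nhds hlim
    (Eventually.of_forall fun _ => zero_le) ?_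
  filter_upwards [hI, eventually_ge_atTop m₀.toNat] with m hIm hm
  have hm0 : m₀ ≤ m := by omega
  set β : ℝ≥0∞ := ENNReal.ofReal (2 ^ (-((m : ℝ) * t))) with hβ
  have hβ0 : 0 < β := ENNReal.ofReal_pos.2 (by positivity)
  let S : ℤ → Finset (Fin d → ℤ) := fun ℓ => (finite_setOf_le_measure_dyadicCube p ν ℓ hβ0).toFinset
  have hS : ∀ ℓ, ((S ℓ).card : ℝ≥0∞) ≤ ENNReal.ofReal (2 ^ ((m : ℝ) * t)) := by
    intro ℓ
    have h := card_mul_le_of_le_measure_dyadicCube (p := p) (ν := ν) (m := ℓ) (β := β) (S := S ℓ)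
      fun k hk => by simpa [S] using hk
    have h1 : ν Set.univ ≤ 1 := by
      rw [hν, Measure.restrict_apply_univ]
      exact prob_le_one
    have h2 : β⁻¹ = ENNReal.ofReal (2 ^ ((m : ℝ) * t)) := by
      rw [hβ, ← ENNReal.ofReal_inv_of_pos (by positivity), Real.rpow_neg (by norm_num), inv_inv]
    rw [← h2, ← one_div]
    exact (ENNReal.le_div_iff_mul_le (Or.inl hβ0.ne') (Or.inl ENNReal.ofReal_ne_top)).2
      (h.trans h1)
  let G : ℤ → (Fin d → ℤ) → Set Ω := fun ℓ k => {ω | (1 + ε) * (I m).card *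
    max (ν.real (dyadicCube p ℓ k)) (2 ^ (-((m : ℝ) * κ))) ≤
        (hitCount (I m) (fun n => X n ω) (A ∩ dyadicCube p ℓ k) : ℝ)}
  have hG : ∀ ℓ k, P (G ℓ k) ≤ ENNReal.ofReal (Real.exp (-(c' * 2 ^ ((m : ℝ) * (γ - κ))))) := by
    intro ℓ k
    refine (measure_le_card_filter_le hX hindep hlaw
      (hA.inter (measurableSet_gridCube p _ k)) (I m)
      (a := max (ν.real (dyadicCube p ℓ k)) (2 ^ (-((m : ℝ) * κ)))) hε ?_).trans ?_
    · refine le_max_of_le_left (le_of_eq ?_)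
      rw [Measure.real, Measure.real, hν, Measure.restrict_apply (measurableSet_gridCube p _ k),
        Set.inter_comm]
    · refine ENNReal.ofReal_le_ofReal (Real.exp_le_exp.2 (neg_le_neg ?_))
      have hr := (chernoffRate_pos hε).le
      -- The floor `2^(-mκ)` in the maximum keeps the exponent growing even for cubes of small
      -- measure.
      calc c' * 2 ^ ((m : ℝ) * (γ - κ))
          = chernoffRate ε * (c * 2 ^ ((m : ℝ) * γ)) * 2 ^ (-((m : ℝ) * κ)) := by
            rw [mul_sub, sub_eq_add_neg, Real.rpow_add (by norm_num)]
            ring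
        _ ≤ chernoffRate ε * (I m).card *
            max (ν.real (dyadicCube p ℓ k)) (2 ^ (-((m : ℝ) * κ))) := by
            gcongr
            exact le_max_right _ _
  calc P _ ≤ P (⋃ ℓ ∈ Finset.Icc m₀ (m : ℤ), ⋃ k ∈ S ℓ, G ℓ k) := by
        refine measure_mono ?_
        rintro ω ⟨ℓ, h1, h2, k, h3, h4⟩
        simp only [Set.mem_iUnion]
        exact ⟨ℓ, Finset.mem_Icc.2 ⟨h1, h2⟩, k, by simpa [S] using h3, h4⟩
    _ ≤ ∑ ℓ ∈ Finset.Icc m₀ (m : ℤ), ∑ k ∈ S ℓ, P (G ℓ k) :=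
        (measure_biUnion_finset_le _ _).trans
          (Finset.sum_le_sum fun ℓ _ => measure_biUnion_finset_le _ _)
    _ ≤ ∑ ℓ ∈ Finset.Icc m₀ (m : ℤ), ENNReal.ofReal (2 ^ ((m : ℝ) * t)) *
          ENNReal.ofReal (Real.exp (-(c' * 2 ^ ((m : ℝ) * (γ - κ))))) := by
        refine Finset.sum_le_sum fun ℓ _ => ?_
        refine (Finset.sum_le_card_nsmul _ _ _ fun k _ => hG ℓ k).trans ?_
        rw [nsmul_eq_mul]
        gcongr
        exact hS ℓ
    _ = ENNReal.ofReal ((m + 1 - m₀ : ℝ) / 2 ^ m) *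
      ENNReal.ofReal (2 ^ ((m : ℝ) * (t + 1)) * Real.exp (-(c' * 2 ^ ((m : ℝ) * (γ - κ))))) := by
        rw [Finset.sum_const, nsmul_eq_mul, Int.card_Icc, ← ENNReal.ofReal_natCast,
          ← ENNReal.ofReal_mul (by positivity), ← ENNReal.ofReal_mul (by positivity),
          ← ENNReal.ofReal_mul' (by positivity)]
        congr 1
        have h1 : (((m + 1 - m₀ : ℤ).toNat : ℤ) : ℝ) = (m + 1 - m₀ : ℝ) := by
          rw [Int.toNat_of_nonneg (by omega)]
          push_cast
          ring
        rw [← h1, mul_add, mul_one, Real.rpow_add (by norm_num), Real.rpow_natCast, Int.cast_natCast]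
        field_simp

/-- With high probability a sequence of sets does not attract many more points than expected. -/
theorem tendsto_measure_overfull (hX : ∀ n, Measurable (X n))
    (hindep : iIndepFun X P) (hlaw : ∀ n, P.map (X n) = μ)
    {B : ℕ → Set (EuclideanSpace ℝ (Fin d))} (hB : ∀ m, MeasurableSet (B m)) {a ε : ℝ}
    (ha : 0 < a) (hBa : ∀ᶠ m in atTop, μ.real (B m) ≤ a) (hε : 0 < ε) {I : ℕ → Finset ℕ}
    (hI : Tendsto (fun m => ((I m).card : ℝ)) atTop atTop) :
    Tendsto (fun m : ℕ => P {ω | (1 + ε) * (I m).card * a ≤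
        (hitCount (I m) (fun n => X n ω) (B m) : ℝ)}) atTop (𝓝 0) := by
  have hlim : Tendsto (fun m => ENNReal.ofReal (Real.exp (-(chernoffRate ε * (I m).card * a))))
      atTop (𝓝 0) := by
    rw [← ENNReal.ofReal_zero]
    refine ENNReal.tendsto_ofReal (Real.tendsto_exp_neg_atTop_nhds_zero.comp ?_)
    exact (hI.const_mul_atTop (chernoffRate_pos hε)).atTop_mul_const ha
  refine tendsto_of_tendsto_of_tendsto_of_le_of_le' tendsto_const_nhds hlim
    (Eventually.of_forall fun _ => zero_le) ?_
  filter_upwards [hBa] with m hm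
  exact measure_le_card_filter_le hX hindep hlaw (hB m) (I m) hε hm

end

/-! ### Random balls: full content of the tail unions and of the limsup set -/

/-- The union of the balls `B(x_n, n^{-α})` with index at least `N`. -/
def tailBalls (α : ℝ) (x : ℕ → EuclideanSpace ℝ (Fin d)) (N : ℕ) :
    Set (EuclideanSpace ℝ (Fin d)) :=
  ⋃ n ≥ N, Metric.ball (x n) (((n : ℝ) + 1) ^ (-α))

lemma isOpen_tailBalls (α : ℝ) (x : ℕ → EuclideanSpace ℝ (Fin d)) (N : ℕ) :
    IsOpen (tailBalls α x N) :=
  isOpen_biUnion fun _ _ => Metric.isOpen_ball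

lemma limsupBalls_eq_iInter (α : ℝ) (x : ℕ → EuclideanSpace ℝ (Fin d)) :
    limsupBalls α x = ⋂ N, tailBalls α x N := by
  rw [limsupBalls, limsup_eq_iInf_iSup_of_nat]
  rfl

/-- The number of points whose balls are used to hit cubes of level `m`. -/
def sampleSize (d : ℕ) (α : ℝ) (m : ℕ) : ℕ := ⌊(2 ^ m / ((d : ℝ) + 1)) ^ (1 / α) / 2⌋₊

/-- The sample size is calibrated so that the balls of index below its double have radius at least
`(d+1) 2^(-m)`. Using `d + 1` beats the diameter bound `d 2^(-m)` strictly, as open balls require.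
-/
lemma sampleSize_rpow_mul_le {α : ℝ} (hα : 0 < α) (m : ℕ) :
    (2 * (sampleSize d α m : ℝ)) ^ α * (d + 1) ≤ 2 ^ m := by
  have h : (2 * (sampleSize d α m : ℝ)) ≤ (2 ^ m / ((d : ℝ) + 1)) ^ (1 / α) := by
    have := Nat.floor_le (a := (2 ^ m / ((d : ℝ) + 1)) ^ (1 / α) / 2) (by positivity)
    rw [sampleSize]
    linarith
  have h1 := Real.rpow_le_rpow (by positivity) h hα.le
  rw [← Real.rpow_mul (by positivity), one_div, inv_mul_cancel₀ hα.ne', Real.rpow_one,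
    le_div_iff₀ (by positivity)] at h1
  exact h1

lemma exists_mul_rpow_le_sampleSize (d : ℕ) {α : ℝ} (hα : 0 < α) :
    ∃ c > 0, ∀ᶠ m : ℕ in atTop, c * 2 ^ ((m : ℝ) * (1 / α)) ≤ (sampleSize d α m : ℝ) := by
  set b : ℝ := (((d : ℝ) + 1) ^ (1 / α))⁻¹ / 2 with hb
  have hb0 : 0 < b := by positivity
  refine ⟨b / 2, by positivity, ?_⟩
  filter_upwards [(tendsto_two_rpow_natCast_mul (one_div_pos.2 hα)).eventually_ge_atTop (2 / b)]
    with m hm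
  have h1 : (2 ^ m / ((d : ℝ) + 1)) ^ (1 / α) / 2 = b * 2 ^ ((m : ℝ) * (1 / α)) := by
    rw [Real.div_rpow (by positivity) (by positivity), ← Real.rpow_natCast,
      ← Real.rpow_mul (by norm_num), hb]
    ring
  have h2 := Nat.lt_floor_add_one ((2 ^ m / ((d : ℝ) + 1)) ^ (1 / α) / 2)
  rw [h1] at h2
  rw [div_le_iff₀ hb0] at hm
  rw [sampleSize, h1]
  linarith

lemma cubeAt_subset_ball {α : ℝ} (hα : 0 < α) (p x : EuclideanSpace ℝ (Fin d)) {m n : ℕ}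
    (hn : n < 2 * sampleSize d α m) :
    cubeAt p m x ⊆ Metric.ball x (((n : ℝ) + 1) ^ (-α)) := by
  intro y hy
  refine Metric.mem_ball.2 ((dist_le_of_mem_dyadicCube hy (mem_cubeAt p m x)).trans_lt ?_)
  have h1 : ((n : ℝ) + 1) ^ α ≤ (2 * (sampleSize d α m : ℝ)) ^ α := by
    refine Real.rpow_le_rpow (by positivity) ?_ hα.le
    exact_mod_cast hn
  have h0 : (0 : ℝ) < ((n : ℝ) + 1) ^ α := by positivity
  have h2 := sampleSize_rpow_mul_le (d := d) hα m
  rw [Real.rpow_neg (by positivity), zpow_neg, zpow_natCast, ← div_eq_mul_inv, ← one_div,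
    div_lt_div_iff₀ (by positivity) h0, one_mul]
  have h3 : ((n : ℝ) + 1) ^ α * (d + 1) ≤ (2 * (sampleSize d α m : ℝ)) ^ α * (d + 1) := by gcongr
  linarith

lemma measurableSet_setOf_cubeAt (p : EuclideanSpace ℝ (Fin d)) (m : ℤ)
    (s : Set (Set (EuclideanSpace ℝ (Fin d)))) : MeasurableSet {x | cubeAt p m x ∈ s} :=
  measurable_cubeIdx p m (MeasurableSet.of_discrete (s := {k | dyadicCube p m k ∈ s}))

lemma hitCount_add_hitCount_compl {ι E : Type*} (I : Finset ι) (x : ι → E) (B : Set E) :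
    hitCount I x B + hitCount I x Bᶜ = I.card := by
  classical
  simp only [hitCount, Set.mem_compl_iff]
  convert Finset.card_filter_add_card_filter_not (s := I) fun n => x n ∈ B

section

variable {μ : Measure (EuclideanSpace ℝ (Fin d))} [IsProbabilityMeasure μ]
  {Ω : Type*} [MeasurableSpace Ω] {P : Measure Ω} [IsProbabilityMeasure P]
  {X : ℕ → Ω → EuclideanSpace ℝ (Fin d)}

/-- The balls with large index fill out, in the sense of net content, the interior of a cube, up to
an arbitrarily small error. -/
theorem ae_sub_le_netContent_tailBalls (hX : ∀ n, Measurable (X n))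
    (hindep : iIndepFun X P) (hlaw : ∀ n, P.map (X n) = μ) {α : ℝ} (hα : 0 < α)
    {p : EuclideanSpace ℝ (Fin d)} (hp : μ (dyadicBoundary p) = 0)
    {A : Set (EuclideanSpace ℝ (Fin d))} (hA : MeasurableSet A) {t η : ℝ} (hη0 : 0 < η)
    (hη1 : η ≤ 1) (ht : η * t < 1 / α)
    (hlight : Tendsto (fun m : ℕ => μ.restrict A
      {x | μ.restrict A (cubeAt p m x) < ENNReal.ofReal (2 ^ (-((m : ℝ) * t)))}) atTop (𝓝 0))
    (m₀ : ℤ) (k₀ : Fin d → ℤ) (hQ : μ.restrict A (dyadicCube p m₀ k₀) ≠ 0) (N : ℕ) {ε : ℝ}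
    (hε : 0 < ε) (hε1 : ε ≤ 1) :
    ∀ᵐ ω ∂P, (μ.restrict A).real (dyadicCube p m₀ k₀) - 3 * ε ≤
      (1 + ε) * ((μ.restrict A).real (dyadicCube p m₀ k₀) ^ (1 - η) *
        (netContent p (μ.restrict A) η
          (tailBalls α (fun n => X n ω) N ∩ interior (dyadicCube p m₀ k₀))).toReal) := by
  classical
  set ν := μ.restrict A with hν
  set Q := dyadicCube p m₀ k₀ with hQdef
  have hQm : MeasurableSet Q := measurableSet_gridCube p _ k₀
  have hv0 : 0 < ν.real Q := ENNReal.toReal_pos hQ (measure_ne_top _ _)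
  have hv1 : ν.real Q ≤ 1 := by
    rw [Measure.real, hν, Measure.restrict_apply hQm]
    exact measureReal_le_one
  -- `κ < 1/α` makes the sample size times the floor `2^(-mκ)` grow; `κ > η t` lets `hq` absorb that
  -- floor.
  obtain ⟨κ, hκ1, hκ2⟩ := exists_between ht
  obtain ⟨c, hc, hcM⟩ := exists_mul_rpow_le_sampleSize d hα
  let M : ℕ → ℕ := sampleSize d α
  -- Indices below `2 M` have balls that contain their cubes; indices from `M` on lie in the tail
  -- once `M ≥ N`.
  let I : ℕ → Finset ℕ := fun m => Finset.Ico (M m) (2 * M m)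
  have hIcard : ∀ m, (I m).card = M m := fun m => by
    simp only [I, Nat.card_Ico]
    omega
  let β : ℕ → ℝ≥0∞ := fun m => ENNReal.ofReal (2 ^ (-((m : ℝ) * t)))
  let good : ℕ → Set (EuclideanSpace ℝ (Fin d)) := fun m =>
    A ∩ (Q ∩ {x | β m ≤ ν (cubeAt p m x)})
  have hgood : ∀ m, MeasurableSet (good m) := fun m =>
    hA.inter (hQm.inter (measurableSet_setOf_cubeAt p m {D | β m ≤ ν D}))
  have hMtop : Tendsto (fun m => (M m : ℝ)) atTop atTop :=
    tendsto_atTop_mono' _ hcM ((tendsto_two_rpow_natCast_mul (one_div_pos.2 hα)).const_mul_atTop hc)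
  have hFa := tendsto_measure_exists_overfull hX hindep hlaw p hA m₀ (t := t) hκ2 hc hε (I := I)
    (by simpa only [hIcard] using hcM)
  have hbad : ∀ᶠ m : ℕ in atTop, μ.real (good m)ᶜ ≤ 1 - ν.real Q + ε := by
    filter_upwards [hlight.eventually_le_const (ENNReal.ofReal_pos.2 hε)] with m hm
    have hsub : Q ∩ A ⊆ good m ∪ {x | ν (cubeAt p m x) < β m} ∩ A := by
      rintro x ⟨hxQ, hxA⟩
      rcases lt_or_ge (ν (cubeAt p m x)) (β m) with h | h
      · exact Or.inr ⟨h, hxA⟩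
      · exact Or.inl ⟨hxA, hxQ, h⟩
    have hle : ν Q ≤ μ (good m) + ENNReal.ofReal ε := by
      rw [hν, Measure.restrict_apply hQm]
      refine (measure_mono hsub).trans ((measure_union_le _ _).trans ?_)
      gcongr
      rwa [← Measure.restrict_apply' hA]
    have hle' := ENNReal.toReal_mono (by finiteness) hle
    rw [ENNReal.toReal_add (by finiteness) (by finiteness), ENNReal.toReal_ofReal hε.le] at hle'
    rw [probReal_compl_eq_one_sub (hgood m)]
    simp only [Measure.real]
    linarith
  -- Many points are good because few lie in the complement, so the upper tail bound suffices.
  have hFb := tendsto_measure_overfull hX hindep hlaw (fun m => (hgood m).compl)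
    (a := 1 - ν.real Q + ε) (by linarith) hbad hε (I := I) (by simpa only [hIcard] using hMtop)
  have hF := hFa.add hFb
  rw [add_zero] at hF
  have hF' := ae_frequently_notMem (tendsto_of_tendsto_of_tendsto_of_le_of_le tendsto_const_nhds hF
    (fun _ => zero_le) fun m => measure_union_le _ _)
  have hq : ∀ᶠ m : ℕ in atTop, (2 : ℝ) ^ (-((m : ℝ) * κ)) ≤
      ν.real Q ^ (1 - η) * (2 ^ (-((m : ℝ) * t))) ^ η := by
    have h := (tendsto_two_rpow_neg_natCast_mul (sub_pos.2 hκ1)).eventually_le_const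
      (show 0 < ν.real Q ^ (1 - η) by positivity)
    filter_upwards [h] with m hm
    rw [← Real.rpow_mul (by norm_num)]
    calc (2 : ℝ) ^ (-((m : ℝ) * κ))
        = 2 ^ (-((m : ℝ) * (κ - η * t))) * 2 ^ (-((m : ℝ) * t) * η) := by
          rw [← Real.rpow_add (by norm_num)]
          congr 1
          ring
      _ ≤ _ := by gcongr
  filter_upwards [hF'] with ω hω
  obtain ⟨m, hmF, hqm, hmm₀, hMN⟩ := (hω.and_eventually (hq.and ((eventually_ge_atTop m₀.toNat).and
    (hMtop.eventually_ge_atTop (N + 1 : ℝ))))).exists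
  simp only [Set.mem_union, Set.mem_ofPred_eq, not_or, not_exists, not_and, not_le, hIcard] at hmF
  obtain ⟨hcount, htotal⟩ := hmF
  have hMN' : N + 1 ≤ M m := by exact_mod_cast hMN
  have hM0 : (0 : ℝ) < M m := by
    have : 0 < M m := by omega
    exact_mod_cast this
  let x : ℕ → EuclideanSpace ℝ (Fin d) := fun n => X n ω
  let J : Finset ℕ := (I m).filter fun n => x n ∈ good m
  have hJ : (J.card : ℝ) = M m - hitCount (I m) x (good m)ᶜ := by
    have h := hitCount_add_hitCount_compl (I m) x (good m)
    rw [hIcard] at h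
    rw [← h, show J.card = hitCount (I m) x (good m) by simp only [J, hitCount]; congr]
    simp
  have hkey := card_le_mul_netContent (p := p) (ν := ν) hη0.le hη1 (m₀ := m₀) (m := m)
    (by omega) (k₀ := k₀)
    (by
      have : ν ≪ μ := Measure.absolutelyContinuous_of_le Measure.restrict_le_self
      exact measure_mono_null (frontier_subset_dyadicBoundary (dyadicCube_mem p m₀ k₀)) (this hp))
    (U := tailBalls α x N) J x (fun n hn => (Finset.mem_filter.1 hn).2.2.1)
    (fun n hn => by
      have hnI := Finset.mem_Ico.1 (Finset.mem_filter.1 hn).1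
      exact (cubeAt_subset_ball hα p (x n) hnI.2).trans
        (Set.subset_biUnion_of_mem (u := fun n => Metric.ball (x n) (((n : ℝ) + 1) ^ (-α)))
          (show N ≤ n by omega)))
    (β := β m) (q := ENNReal.ofReal (2 ^ (-((m : ℝ) * κ)))) (a := ENNReal.ofReal ((1 + ε) * M m))
    (ENNReal.ofReal_pos.2 (by positivity)).ne' ENNReal.ofReal_ne_top
    (fun n hn => (Finset.mem_filter.1 hn).2.2.2)
    (fun ℓ h1 h2 k hk => by
      have h := hcount ℓ h1 h2 k hk
      have hle : hitCount J x (dyadicCube p ℓ k) ≤ hitCount (I m) x (A ∩ dyadicCube p ℓ k) := by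
        refine Finset.card_le_card fun n hn => ?_
        simp only [J, Finset.mem_filter] at hn ⊢
        exact ⟨hn.1.1, hn.1.2.1, hn.2⟩
      rw [← ENNReal.ofReal_toReal (measure_ne_top ν (dyadicCube p ℓ k)), ← ENNReal.ofReal_max,
        ← ENNReal.ofReal_mul (by positivity), ← ENNReal.ofReal_natCast]
      exact ENNReal.ofReal_le_ofReal ((Nat.cast_le.2 hle).trans h.le))
    (by
      rw [← ENNReal.ofReal_toReal (measure_ne_top ν (dyadicCube p m₀ k₀)),
        ENNReal.ofReal_rpow_of_nonneg ENNReal.toReal_nonneg (by linarith),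
        ENNReal.ofReal_rpow_of_nonneg (by positivity) hη0.le,
        ← ENNReal.ofReal_mul (by positivity)]
      exact ENNReal.ofReal_le_ofReal hqm)
  have hfin : netContent p ν η (tailBalls α x N ∩ interior Q) ≠ ⊤ :=
    (((netContent_mono p ν η (Set.inter_subset_right.trans interior_subset)).trans
      (netContent_le_of_mem ν η (dyadicCube_mem p m₀ k₀))).trans_lt
        (ENNReal.rpow_lt_top_of_nonneg hη0.le (measure_ne_top _ _))).ne
  have hreal := ENNReal.toReal_mono (ENNReal.mul_ne_top (ENNReal.mul_ne_top ENNReal.ofReal_ne_top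
    (ENNReal.rpow_ne_top_of_nonneg (by linarith) (measure_ne_top ν Q))) hfin) hkey
  rw [ENNReal.toReal_mul, ENNReal.toReal_mul, ENNReal.toReal_ofReal (by positivity),
    ← ENNReal.toReal_rpow, ENNReal.toReal_natCast, hJ] at hreal
  refine le_of_mul_le_mul_left ?_ hM0
  -- With `v = ν(Q)`, one has `(1 + ε)(1 - v + ε) ≤ 1 - v + 3ε`, because `ε ≤ 1 + v`.
  calc M m * (ν.real Q - 3 * ε) ≤ M m - (1 + ε) * M m * (1 - ν.real Q + ε) := by
        rw [show (M m : ℝ) - (1 + ε) * M m * (1 - ν.real Q + ε) =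
          M m * (1 - (1 + ε) * (1 - ν.real Q + ε)) by ring]
        refine mul_le_mul_of_nonneg_left ?_ hM0.le
        nlinarith [mul_nonneg hε.le (show 0 ≤ 1 + ν.real Q - ε by linarith)]
    _ ≤ M m - hitCount (I m) x (good m)ᶜ := by gcongr
    _ ≤ _ := hreal.trans_eq (by rw [Measure.real]; ring)

/-- Almost surely the net content of the limsup set in every dyadic cube is full. -/
theorem ae_le_netContent_limsupBalls (hX : ∀ n, Measurable (X n))
    (hindep : iIndepFun X P) (hlaw : ∀ n, P.map (X n) = μ) {α : ℝ} (hα : 0 < α)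
    {p : EuclideanSpace ℝ (Fin d)} (hp : μ (dyadicBoundary p) = 0)
    {A : Set (EuclideanSpace ℝ (Fin d))} (hA : MeasurableSet A) {t η : ℝ} (hη0 : 0 < η)
    (hη1 : η ≤ 1) (ht : η * t < 1 / α)
    (hlight : Tendsto (fun m : ℕ => μ.restrict A
      {x | μ.restrict A (cubeAt p m x) < ENNReal.ofReal (2 ^ (-((m : ℝ) * t)))}) atTop (𝓝 0)) :
    ∀ᵐ ω ∂P, ∀ D ∈ dyadicCubes p, μ.restrict A D ^ η ≤
      netContent p (μ.restrict A) η (limsupBalls α (fun n => X n ω) ∩ D) := by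
  set ν := μ.restrict A with hν
  have h : ∀ (m₀ : ℤ) (k₀ : Fin d → ℤ) (N j : ℕ), ∀ᵐ ω ∂P, ν (dyadicCube p m₀ k₀) ≠ 0 →
      ν.real (dyadicCube p m₀ k₀) - 3 * (1 / ((j : ℝ) + 1)) ≤
      (1 + 1 / ((j : ℝ) + 1)) * (ν.real (dyadicCube p m₀ k₀) ^ (1 - η) *
        (netContent p ν η
          (tailBalls α (fun n => X n ω) N ∩ interior (dyadicCube p m₀ k₀))).toReal) := by
    intro m₀ k₀ N j
    by_cases hQ : ν (dyadicCube p m₀ k₀) = 0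
    · exact ae_of_all _ fun ω h => absurd hQ h
    · filter_upwards [ae_sub_le_netContent_tailBalls hX hindep hlaw hα hp hA hη0 hη1 ht hlight
        m₀ k₀ hQ N (ε := 1 / ((j : ℝ) + 1)) (by positivity)
        (by rw [div_le_one (by positivity)]; linarith [j.cast_nonneg (α := ℝ)])] with ω hω _
      exact hω
  simp only [← ae_all_iff] at h
  filter_upwards [h] with ω hω D hD
  rw [limsupBalls_eq_iInter]
  refine le_netContent_iInter hη0.le (isOpen_tailBalls α _) (fun N Q hQ => ?_) hD
  obtain ⟨m₀, k₀, rfl⟩ := hQ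
  change ν (dyadicCube p m₀ k₀) ^ η ≤ netContent p ν η (_ ∩ interior (dyadicCube p m₀ k₀))
  by_cases h0 : ν (dyadicCube p m₀ k₀) = 0
  · rw [h0, ENNReal.zero_rpow_of_pos hη0]
    exact zero_le
  have hlim : Tendsto (fun j : ℕ => 1 / ((j : ℝ) + 1)) atTop (𝓝 0) :=
    tendsto_one_div_add_atTop_nhds_zero_nat
  -- Letting `ε = 1/(j+1)` tend to zero leaves `ν(Q) ≤ ν(Q)^(1-η)` times the content; dividing gives
  -- the claim.
  have hle := le_of_tendsto_of_tendsto' ((hlim.const_mul 3).const_sub _)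
    ((hlim.const_add 1).mul_const _) fun j => hω m₀ k₀ N j h0
  have hv0 : 0 < ν.real (dyadicCube p m₀ k₀) := ENNReal.toReal_pos h0 (measure_ne_top _ _)
  rw [mul_zero, sub_zero, add_zero, one_mul] at hle
  have hle' : ν.real (dyadicCube p m₀ k₀) ^ η ≤ (netContent p ν η
      (tailBalls α (fun n => X n ω) N ∩ interior (dyadicCube p m₀ k₀))).toReal := by
    refine le_of_mul_le_mul_left (le_of_eq_of_le ?_ hle)
      (show 0 < ν.real (dyadicCube p m₀ k₀) ^ (1 - η) by positivity)
    rw [← Real.rpow_add hv0, sub_add_cancel, Real.rpow_one]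
  rw [← ofReal_measureReal (μ := ν) (s := dyadicCube p m₀ k₀), ENNReal.ofReal_rpow_of_pos hv0]
  exact (ENNReal.ofReal_le_ofReal hle').trans ENNReal.ofReal_toReal_le

end

/-! ### The coarse spectrum and the mass of light cubes -/

/-- The number `2 ^ (-m t)`. -/
def dyadicPow (m : ℕ) (t : ℝ) : ℝ≥0∞ := ENNReal.ofReal (2 ^ (-((m : ℝ) * t)))

lemma dyadicPow_pos (m : ℕ) (t : ℝ) : 0 < dyadicPow m t :=
  ENNReal.ofReal_pos.2 (by positivity)

lemma dyadicPow_add (m : ℕ) (t u : ℝ) : dyadicPow m (t + u) = dyadicPow m t * dyadicPow m u := by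
  rw [dyadicPow, dyadicPow, dyadicPow, ← ENNReal.ofReal_mul (by positivity),
    ← Real.rpow_add (by norm_num)]
  congr 2
  ring

lemma dyadicPow_anti (m : ℕ) : Antitone (dyadicPow m) := fun t u h =>
  ENNReal.ofReal_le_ofReal (Real.rpow_le_rpow_of_exponent_le (by norm_num) (by gcongr))

lemma tendsto_dyadicPow {t : ℝ} (ht : 0 < t) : Tendsto (fun m => dyadicPow m t) atTop (𝓝 0) := by
  rw [← ENNReal.ofReal_zero]
  exact ENNReal.tendsto_ofReal (tendsto_two_rpow_neg_natCast_mul ht)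

lemma ofReal_two_zpow_neg_rpow (m : ℕ) (t : ℝ) :
    ENNReal.ofReal (((2 : ℝ) ^ (-(m : ℤ))) ^ t) = dyadicPow m t := by
  rw [dyadicPow, ← Real.rpow_intCast, ← Real.rpow_mul (by norm_num)]
  congr 2
  push_cast
  ring

lemma exists_eq_dyadicPow {m : ℕ} (hm : m ≠ 0) {a : ℝ≥0∞} (h0 : a ≠ 0) (h1 : a ≠ ⊤) :
    ∃ t, a = dyadicPow m t := by
  have ha : 0 < a.toReal := ENNReal.toReal_pos h0 h1
  have hm' : (m : ℝ) ≠ 0 := by exact_mod_cast hm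
  have hl : Real.log 2 ≠ 0 := (Real.log_pos (by norm_num)).ne'
  refine ⟨-(Real.log a.toReal / Real.log 2 / m), ?_⟩
  rw [dyadicPow, Real.rpow_def_of_pos (by norm_num)]
  rw [show Real.log 2 * -((m : ℝ) * -(Real.log a.toReal / Real.log 2 / m)) = Real.log a.toReal by
    field_simp, Real.exp_log ha, ENNReal.ofReal_toReal h1]

lemma dyadicPow_lt_dyadicPow_iff {m : ℕ} (hm : m ≠ 0) {t u : ℝ} :
    dyadicPow m t < dyadicPow m u ↔ u < t := by
  have hm' : (0 : ℝ) < m := by exact_mod_cast Nat.pos_of_ne_zero hm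
  rw [dyadicPow, dyadicPow, ENNReal.ofReal_lt_ofReal_iff (by positivity),
    Real.rpow_lt_rpow_left_iff (by norm_num), neg_lt_neg_iff, mul_lt_mul_iff_right₀ hm']

/-- The set of points whose level `m` cubes have measure between `2 ^ (-m b)` and `2 ^ (-m a)` is
asymptotically negligible, if the coarse spectrum is small enough around `a` and `b`. -/
lemma exists_tendsto_measure_window (μ : Measure (EuclideanSpace ℝ (Fin d)))
    [IsProbabilityMeasure μ] {u c : ℝ} (hcu : c < u) (h : coarseSpectrum μ u < (c : EReal)) :
    ∃ δ > 0, Tendsto (fun m : ℕ => μ {x | dyadicPow m (u + δ) ≤ μ (cubeAt 0 m x) ∧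
      μ (cubeAt 0 m x) < dyadicPow m (u - δ)}) atTop (𝓝 0) := by
  -- Eventually fewer than `2^(mc)` cubes lie in the window, each of measure below `2^(-m(u-δ))`.
  -- Their total mass is at most `2^(-m(u-c-δ))`, which vanishes as `δ < u - c`.
  obtain ⟨δ, hδlt, hδ0, hδc⟩ := (((tendsto_coarseGrowth μ u).eventually_lt_const h).and
    ((eventually_mem_nhdsWithin).and (nhdsWithin_le_nhds (eventually_lt_nhds (sub_pos.2 hcu))))).exists
  have hδ0 : 0 < δ := hδ0
  refine ⟨δ, hδ0, ?_⟩
  have hr : Tendsto (fun m : ℕ => (2 : ℝ) ^ (-(m : ℤ))) atTop (𝓝[>] 0) :=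
    tendsto_nhdsWithin_iff.2 ⟨tendsto_two_zpow_neg,
      Eventually.of_forall fun m => Set.mem_Ioi.2 (by positivity)⟩
  have hev := hr.eventually (eventually_lt_of_limsup_lt hδlt)
  refine tendsto_of_tendsto_of_tendsto_of_le_of_le' tendsto_const_nhds
    (tendsto_dyadicPow (sub_pos.2 hδc)) (Eventually.of_forall fun _ => zero_le) ?_
  filter_upwards [hev, eventually_ge_atTop 1] with m hm hm1
  set r : ℝ := (2 : ℝ) ^ (-(m : ℤ)) with hrdef
  have hr0 : 0 < r := by positivity
  have hr1 : r < 1 := zpow_lt_one_of_neg₀ (by norm_num) (by omega)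
  have hlogr : -Real.log r = m * Real.log 2 := by
    rw [hrdef, Real.log_zpow]
    push_cast
    ring
  have hlog0 : 0 < -Real.log r := neg_pos.2 (Real.log_neg hr0 hr1)
  rw [EReal.div_lt_iff (by exact_mod_cast hlog0) (EReal.coe_ne_top _), ← EReal.coe_mul,
    ← EReal.exp_lt_exp_iff, ENNReal.exp_log, EReal.exp_coe] at hm
  have hexp : ENNReal.ofReal (Real.exp (c * -Real.log r)) = dyadicPow m (-c) := by
    rw [hlogr, dyadicPow, Real.rpow_def_of_pos (by norm_num)]
    congr 2
    ring
  rw [hexp] at hm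
  have hfin := heavyCubes_finite μ (u + δ) hr0
  have hfin' := heavyCubes_finite μ (u - δ) hr0
  have hsub : heavyCubes μ (u - δ) r ⊆ heavyCubes μ (u + δ) r := fun k hk =>
    le_trans (ENNReal.ofReal_le_ofReal
      (Real.rpow_le_rpow_of_exponent_ge hr0 hr1.le (by linarith))) hk
  set S : Set (Fin d → ℤ) := heavyCubes μ (u + δ) r \ heavyCubes μ (u - δ) r with hS
  have hSfin : S.Finite := hfin.subset Set.sdiff_subset
  have hcard : hSfin.toFinset.card = cubeCount μ (u + δ) r - cubeCount μ (u - δ) r := by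
    rw [← Set.ncard_eq_toFinset_card S hSfin, hS, Set.ncard_sdiff hsub hfin']
    rfl
  calc μ {x | dyadicPow m (u + δ) ≤ μ (cubeAt 0 m x) ∧ μ (cubeAt 0 m x) < dyadicPow m (u - δ)}
      ≤ μ (⋃ k ∈ hSfin.toFinset, dyadicCube 0 m k) := by
        refine measure_mono fun x hx => ?_
        simp only [Set.mem_iUnion]
        refine ⟨cubeIdx 0 m x, ?_, mem_cubeAt 0 m x⟩
        rw [Set.Finite.mem_toFinset, hS]
        simp only [heavyCubes, hrdef, ofReal_two_zpow_neg_rpow]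
        exact ⟨hx.1, not_le.2 hx.2⟩
    _ ≤ ∑ k ∈ hSfin.toFinset, μ (dyadicCube 0 m k) := measure_biUnion_finset_le _ _
    _ ≤ hSfin.toFinset.card * dyadicPow m (u - δ) := by
        rw [← nsmul_eq_mul]
        refine Finset.sum_le_card_nsmul _ _ _ fun k hk => ?_
        rw [Set.Finite.mem_toFinset, hS] at hk
        have := hk.2
        simp only [heavyCubes, hrdef, ofReal_two_zpow_neg_rpow, Set.mem_ofPred_eq, not_le] at this
        exact this.le
    _ ≤ dyadicPow m (-c) * dyadicPow m (u - δ) := by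
        rw [hcard]
        gcongr
    _ = dyadicPow m (u - c - δ) := by
        rw [← dyadicPow_add]
        congr 1
        ring

lemma tendsto_measure_compl_closedBall (μ : Measure (EuclideanSpace ℝ (Fin d)))
    [IsFiniteMeasure μ] :
    Tendsto (fun j : ℕ => μ (Metric.closedBall 0 (j : ℝ))ᶜ) atTop (𝓝 0) := by
  have h := tendsto_measure_iInter_atTop (μ := μ)
    (s := fun j : ℕ => (Metric.closedBall (0 : EuclideanSpace ℝ (Fin d)) (j : ℝ))ᶜ)
    (fun j => Metric.isClosed_closedBall.measurableSet.compl.nullMeasurableSet)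
    (fun i j hij => Set.compl_subset_compl.2 (Metric.closedBall_subset_closedBall (by
      exact_mod_cast hij))) ⟨0, measure_ne_top _ _⟩
  rwa [← Set.compl_iUnion, Metric.iUnion_closedBall_nat, Set.compl_univ, measure_empty] at h

/-- Cubes of side `r` and measure much less than `r ^ d` carry little mass. -/
lemma tendsto_measure_very_light (μ : Measure (EuclideanSpace ℝ (Fin d))) [IsFiniteMeasure μ] :
    Tendsto (fun m : ℕ => μ {x | μ (cubeAt 0 m x) < dyadicPow m (d + 1)}) atTop (𝓝 0) := by
  rw [ENNReal.tendsto_nhds_zero]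
  intro ε hε
  have hε2 : 0 < ε / 2 := ENNReal.half_pos hε.ne'
  -- Tightness replaces bounded support: at most `((2j+1) 2^m)^d` cubes are needed inside the ball,
  -- and the light ones have total mass at most `(2j+1)^d 2^(-m)`.
  obtain ⟨j, hj⟩ := ((tendsto_measure_compl_closedBall μ).eventually_le_const hε2).exists
  have hlim : Tendsto (fun m : ℕ => ((2 * j + 1 : ℕ) : ℝ≥0∞) ^ d * dyadicPow m 1) atTop (𝓝 0) := by
    simpa using ENNReal.Tendsto.const_mul (a := ((2 * j + 1 : ℕ) : ℝ≥0∞) ^ d)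
      (tendsto_dyadicPow one_pos) (Or.inr (by finiteness))
  filter_upwards [hlim.eventually_le_const hε2] with m hm
  let K : Finset (Fin d → ℤ) :=
    Fintype.piFinset fun _ => Finset.Icc (-((j * 2 ^ m : ℕ) : ℤ)) ((j * 2 ^ m : ℕ) : ℤ)
  have hK : K.card ≤ ((2 * j + 1) * 2 ^ m) ^ d := by
    simp only [K, Fintype.card_piFinset, Int.card_Icc, Finset.prod_const, Finset.card_univ,
      Fintype.card_fin]
    refine Nat.pow_le_pow_left ?_ d
    have h1 : (((j * 2 ^ m : ℕ) : ℤ) + 1 - -((j * 2 ^ m : ℕ) : ℤ)).toNat = 2 * (j * 2 ^ m) + 1 := by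
      omega
    rw [h1, add_mul, one_mul, mul_assoc]
    have := Nat.one_le_two_pow (n := m)
    omega
  classical
  let S := K.filter fun k => μ (dyadicCube 0 m k) < dyadicPow m (d + 1)
  have hsub : {x | μ (cubeAt 0 m x) < dyadicPow m (d + 1)} ⊆
      (Metric.closedBall 0 (j : ℝ))ᶜ ∪ ⋃ k ∈ S, dyadicCube 0 m k := by
    intro x hx
    by_cases hxj : x ∈ Metric.closedBall (0 : EuclideanSpace ℝ (Fin d)) (j : ℝ)
    · right
      simp only [Set.mem_iUnion]
      refine ⟨cubeIdx 0 m x, Finset.mem_filter.2 ⟨Fintype.mem_piFinset.2 fun i => ?_, hx⟩,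
        mem_cubeAt 0 m x⟩
      have h1 : |x i| ≤ j := by
        rw [mem_closedBall_zero_iff] at hxj
        exact (PiLp.norm_apply_le x i).trans hxj
      have h2 : (0 : ℝ) < 2 ^ m := by positivity
      rw [abs_le] at h1
      simp only [cubeIdx, PiLp.zero_apply, sub_zero, zpow_natCast, Finset.mem_Icc]
      constructor
      · rw [Int.le_floor]
        push_cast
        nlinarith
      · refine Int.cast_le.1 ((Int.floor_le _).trans ?_ : ((_ : ℤ) : ℝ) ≤ _)
        push_cast
        nlinarith
    · exact Or.inl hxj
  have hpow : ((((2 * j + 1) * 2 ^ m) ^ d : ℕ) : ℝ≥0∞) * dyadicPow m (d + 1) =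
      ((2 * j + 1 : ℕ) : ℝ≥0∞) ^ d * dyadicPow m 1 := by
    have h : (((2 ^ m) ^ d : ℕ) : ℝ≥0∞) * dyadicPow m d = 1 := by
      rw [dyadicPow, Real.rpow_neg (by norm_num), Real.rpow_mul (by norm_num), Real.rpow_natCast,
        Real.rpow_natCast, ← ENNReal.ofReal_natCast, ← ENNReal.ofReal_mul (by positivity)]
      push_cast
      rw [mul_inv_cancel₀ (by positivity), ENNReal.ofReal_one]
    rw [dyadicPow_add, mul_pow, Nat.cast_mul, ← Nat.cast_pow]
    calc _ = (((2 * j + 1) ^ d : ℕ) : ℝ≥0∞) * ((((2 ^ m) ^ d : ℕ) : ℝ≥0∞) * dyadicPow m d) *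
          dyadicPow m 1 := by ring
      _ = _ := by rw [h, mul_one]
  calc μ {x | μ (cubeAt 0 m x) < dyadicPow m (d + 1)}
      ≤ μ (Metric.closedBall 0 (j : ℝ))ᶜ + ∑ k ∈ S, μ (dyadicCube 0 m k) :=
        (measure_mono hsub).trans ((measure_union_le _ _).trans (by
          gcongr
          exact measure_biUnion_finset_le _ _))
    _ ≤ ε / 2 + S.card * dyadicPow m (d + 1) := by
        gcongr
        rw [← nsmul_eq_mul]
        exact Finset.sum_le_card_nsmul _ _ _ fun k hk => (Finset.mem_filter.1 hk).2.le
    _ ≤ ε / 2 + ε / 2 := by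
        gcongr
        refine le_trans ?_ hm
        rw [← hpow]
        gcongr
        exact (Finset.card_filter_le _ _).trans hK
    _ = ε := ENNReal.add_halves ε

/-- Cubes of side `r` and measure less than `r ^ t` carry little mass if `t` exceeds the critical
exponent. -/
theorem tendsto_measure_light (μ : Measure (EuclideanSpace ℝ (Fin d))) [IsProbabilityMeasure μ]
    {t : ℝ} (ht : criticalExponent μ < (t : EReal)) :
    Tendsto (fun m : ℕ => μ {x | μ (cubeAt 0 m x) < dyadicPow m t}) atTop (𝓝 0) := by
  -- The outer limit in the definition of the critical exponent supplies a gap `ε` that is uniform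
  -- over all `u ≥ t`.
  obtain ⟨ε, hεt, hε⟩ := (((tendsto_thresholdSup μ).eventually_lt_const ht).and
    eventually_mem_nhdsWithin).exists
  have hε : 0 < ε := hε
  have hspec : ∀ u, t ≤ u → coarseSpectrum μ u < ((u - ε : ℝ) : EReal) := by
    intro u hu
    by_contra! hcon
    have h1 : (u : EReal) ≤ thresholdSup μ ε :=
      le_biSup (f := fun u : ℝ => (u : EReal)) hcon
    exact absurd (h1.trans_lt hεt) (not_lt.2 (EReal.coe_le_coe_iff.2 hu))
  have hwin : Tendsto (fun m : ℕ => μ {x | ∃ u ∈ Set.Icc t (d + 1),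
      μ (cubeAt 0 m x) = dyadicPow m u}) atTop (𝓝 0) := by
    -- Each exponent has a negligible window around it, and finitely many windows cover `[t, d+1]`.
    refine isCompact_Icc.induction_on
      (p := fun s : Set ℝ => Tendsto (fun m : ℕ => μ {x | ∃ u ∈ s,
        μ (cubeAt 0 m x) = dyadicPow m u}) atTop (𝓝 0)) ?_ ?_ ?_ ?_
    · simp
    · intro s s' hss' h
      exact tendsto_of_tendsto_of_tendsto_of_le_of_le tendsto_const_nhds h (fun _ => zero_le)
        fun m => measure_mono fun x ⟨u, hu, hx⟩ => ⟨u, hss' hu, hx⟩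
    · intro s s' h h'
      have hadd := h.add h'
      rw [add_zero] at hadd
      refine tendsto_of_tendsto_of_tendsto_of_le_of_le tendsto_const_nhds hadd (fun _ => zero_le)
        fun m => (measure_mono ?_).trans (measure_union_le _ _)
      rintro x ⟨u, hu | hu, hx⟩
      · exact Or.inl ⟨u, hu, hx⟩
      · exact Or.inr ⟨u, hu, hx⟩
    · intro u hu
      obtain ⟨δ, hδ, hlim⟩ := exists_tendsto_measure_window μ (c := u - ε) (by linarith)
        (hspec u hu.1)
      refine ⟨Set.Ioo (u - δ) (u + δ), mem_nhdsWithin_of_mem_nhds (Ioo_mem_nhds (by linarith)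
        (by linarith)), ?_⟩
      refine tendsto_of_tendsto_of_tendsto_of_le_of_le' tendsto_const_nhds hlim
        (Eventually.of_forall fun _ => zero_le) ?_
      filter_upwards [eventually_ne_atTop 0] with m hm
      refine measure_mono ?_
      rintro x ⟨v, hv, hx⟩
      refine ⟨?_, ?_⟩ <;> rw [hx]
      · exact dyadicPow_anti m hv.2.le
      · exact (dyadicPow_lt_dyadicPow_iff hm).2 hv.1
  have hadd := hwin.add (tendsto_measure_very_light μ)
  rw [add_zero] at hadd
  refine tendsto_of_tendsto_of_tendsto_of_le_of_le' tendsto_const_nhds hadd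
    (Eventually.of_forall fun _ => zero_le) ?_
  filter_upwards [eventually_ne_atTop 0] with m hm
  refine (measure_mono fun x hx => ?_).trans (measure_union_le _ _)
  rcases lt_or_ge (μ (cubeAt 0 m x)) (dyadicPow m (d + 1)) with h | h
  · exact Or.inr h
  · left
    obtain ⟨u, hu⟩ := exists_eq_dyadicPow hm ((dyadicPow_pos m _).trans_le h).ne'
      (measure_ne_top μ (cubeAt 0 m x))
    refine ⟨u, ⟨?_, ?_⟩, hu⟩
    · have hx : μ (cubeAt 0 m x) < dyadicPow m t := hx
      rw [hu] at hx
      exact ((dyadicPow_lt_dyadicPow_iff hm).1 hx).le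
    · rw [hu] at h
      exact not_lt.1 fun h' => absurd h (not_le.2 ((dyadicPow_lt_dyadicPow_iff hm).2 h'))

/-- The property of `tendsto_measure_light` passes to other dyadic grids and to restrictions of the
measure. -/
theorem tendsto_measure_restrict_light {μ : Measure (EuclideanSpace ℝ (Fin d))}
    [IsProbabilityMeasure μ] {t t' : ℝ} (htt' : t < t')
    (h : Tendsto (fun m : ℕ => μ {x | μ (cubeAt 0 m x) < dyadicPow m t}) atTop (𝓝 0))
    (p : EuclideanSpace ℝ (Fin d)) (A : Set (EuclideanSpace ℝ (Fin d))) :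
    Tendsto (fun m : ℕ => μ.restrict A {x | μ.restrict A (cubeAt p m x) < dyadicPow m t'})
      atTop (𝓝 0) := by
  set ν := μ.restrict A with hν
  have hle : ν ≤ μ := Measure.restrict_le_self
  have hlim : Tendsto (fun m : ℕ => μ {x | μ (cubeAt 0 m x) < dyadicPow m t} +
      (2 ^ d : ℕ) * dyadicPow m (t' - t)) atTop (𝓝 0) := by
    simpa using h.add (ENNReal.Tendsto.const_mul (a := ((2 ^ d : ℕ) : ℝ≥0∞))
      (tendsto_dyadicPow (sub_pos.2 htt')) (Or.inr (by finiteness)))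
  refine tendsto_of_tendsto_of_tendsto_of_le_of_le tendsto_const_nhds hlim (fun _ => zero_le)
    fun m => ?_
  have hfin := finite_setOf_le_measure_dyadicCube 0 μ m (dyadicPow_pos m t)
  have hcard : hfin.toFinset.card * dyadicPow m t ≤ 1 := by
    rw [← measure_univ (μ := μ)]
    exact card_mul_le_of_le_measure_dyadicCube fun k hk => (Set.Finite.mem_toFinset hfin).1 hk
  -- Changing the base point shifts each index by a fixed integer, up to an error in `{-1, 0}`. So
  -- the at most `2^(mt)` heavy cubes at `0` meet at most `2^d 2^(mt)` cubes at `p`, and the light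
  -- ones among these have total mass at most `2^d 2^(-m(t'-t))`.
  let e : Finset (Fin d → ℤ) := Fintype.piFinset fun _ => ({-1, 0} : Finset ℤ)
  have he : e.card = 2 ^ d := by simp [e]
  let T := (hfin.toFinset ×ˢ e).image fun q => fun i => q.1 i - ⌊p i * 2 ^ m⌋ + q.2 i
  classical
  let T' := T.filter fun k => ν (dyadicCube p m k) < dyadicPow m t'
  have hsub : {x | ν (cubeAt p m x) < dyadicPow m t'} ⊆
      {x | μ (cubeAt 0 m x) < dyadicPow m t} ∪ ⋃ k ∈ T', dyadicCube p m k := by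
    intro x hx
    rcases lt_or_ge (μ (cubeAt 0 m x)) (dyadicPow m t) with h0 | h0
    · exact Or.inl h0
    right
    simp only [Set.mem_iUnion]
    refine ⟨cubeIdx p m x, Finset.mem_filter.2 ⟨Finset.mem_image.2
      ⟨(cubeIdx 0 m x, fun i => cubeIdx p m x i - (cubeIdx 0 m x i - ⌊p i * 2 ^ m⌋)),
        Finset.mem_product.2 ⟨(Set.Finite.mem_toFinset hfin).2 h0,
          Fintype.mem_piFinset.2 fun i => ?_⟩, ?_⟩, hx⟩, mem_cubeAt p m x⟩
    · simp only [cubeIdx, PiLp.zero_apply, sub_zero, zpow_natCast, Finset.mem_insert,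
        Finset.mem_singleton, sub_mul]
      have h1 := Int.floor_le (x i * 2 ^ m)
      have h2 := Int.lt_floor_add_one (x i * 2 ^ m)
      have h3 := Int.floor_le (p i * 2 ^ m)
      have h4 := Int.lt_floor_add_one (p i * 2 ^ m)
      have h5 := Int.floor_le (x i * 2 ^ m - p i * 2 ^ m)
      have h6 := Int.lt_floor_add_one (x i * 2 ^ m - p i * 2 ^ m)
      have h7 : ⌊x i * 2 ^ m⌋ - ⌊p i * 2 ^ m⌋ - 2 < ⌊x i * 2 ^ m - p i * 2 ^ m⌋ := by
        rw [← Int.cast_lt (R := ℝ)]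
        push_cast
        linarith
      have h8 : ⌊x i * 2 ^ m - p i * 2 ^ m⌋ < ⌊x i * 2 ^ m⌋ - ⌊p i * 2 ^ m⌋ + 1 := by
        rw [← Int.cast_lt (R := ℝ)]
        push_cast
        linarith
      omega
    · funext i
      ring
  calc ν {x | ν (cubeAt p m x) < dyadicPow m t'}
      ≤ ν {x | μ (cubeAt 0 m x) < dyadicPow m t} + ∑ k ∈ T', ν (dyadicCube p m k) :=
        (measure_mono hsub).trans ((measure_union_le _ _).trans (by
          gcongr
          exact measure_biUnion_finset_le _ _))
    _ ≤ μ {x | μ (cubeAt 0 m x) < dyadicPow m t} + T'.card * dyadicPow m t' := by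
        refine add_le_add (hle _) ?_
        rw [← nsmul_eq_mul]
        exact Finset.sum_le_card_nsmul _ _ _ fun k hk => (Finset.mem_filter.1 hk).2.le
    _ ≤ μ {x | μ (cubeAt 0 m x) < dyadicPow m t} +
          ((hfin.toFinset.card * 2 ^ d : ℕ) : ℝ≥0∞) * dyadicPow m t' := by
        gcongr
        refine (Finset.card_filter_le _ _).trans (Finset.card_image_le.trans_eq ?_)
        rw [Finset.card_product, he]
    _ = μ {x | μ (cubeAt 0 m x) < dyadicPow m t} +
          (2 ^ d : ℕ) * dyadicPow m (t' - t) * (hfin.toFinset.card * dyadicPow m t) := by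
        rw [show t' = (t' - t) + t by ring, dyadicPow_add, Nat.cast_mul]
        ring_nf
    _ ≤ _ := add_le_add le_rfl ((mul_le_mul_right hcard _).trans_eq (mul_one _))

/-! ### Smaller exponents and grids with null boundaries -/

/-- Full net content for an exponent implies full net content for smaller exponents. -/
lemma le_netContent_of_exponent_le {p : EuclideanSpace ℝ (Fin d)}
    {ν : Measure (EuclideanSpace ℝ (Fin d))} [IsFiniteMeasure ν] {η η' : ℝ} (hη : 0 < η)
    (hηη' : η ≤ η') {E D : Set (EuclideanSpace ℝ (Fin d))} (hD : D ∈ dyadicCubes p)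
    (h : ν D ^ η' ≤ netContent p ν η' (E ∩ D)) : ν D ^ η ≤ netContent p ν η (E ∩ D) := by
  refine le_netContent_iff.2 fun C hC hcov => ?_
  by_cases hbig : ∃ K ∈ C, D ⊆ K
  · obtain ⟨K, hK, hDK⟩ := hbig
    calc ν D ^ η ≤ ν K ^ η := by gcongr
      _ ≤ _ := ENNReal.le_tsum (f := fun K : C => ν (K : Set (EuclideanSpace ℝ (Fin d))) ^ η) ⟨K, hK⟩
  push Not at hbig
  rcases eq_or_ne (ν D) 0 with h0 | h0
  · rw [h0, ENNReal.zero_rpow_of_pos hη]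
    exact zero_le
  -- If no member of the cover contains `D`, the subcubes of `D` suffice. For them `ν(K)^(η'-η) ≤
  -- ν(D)^(η'-η)`, and this factor cancels.
  let C' : Set (Set (EuclideanSpace ℝ (Fin d))) := {K | K ∈ C ∧ K ⊆ D}
  have hC' : E ∩ D ⊆ ⋃₀ C' := by
    intro x hx
    obtain ⟨K, hK, hxK⟩ := hcov hx
    exact ⟨K, ⟨hK, (subset_or_subset_of_mem (hC hK) hD hxK hx.2).resolve_right (hbig K hK)⟩, hxK⟩
  have hsplit : ∀ a : ℝ≥0∞, a ^ η' = a ^ (η' - η) * a ^ η := by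
    intro a
    rw [← ENNReal.rpow_add_of_nonneg _ _ (by linarith) hη.le, sub_add_cancel]
  have hle : ν D ^ (η' - η) * ν D ^ η ≤ ν D ^ (η' - η) *
      ∑' K : C', ν (K : Set (EuclideanSpace ℝ (Fin d))) ^ η := by
    rw [← hsplit]
    refine h.trans ((le_netContent_iff.1 le_rfl C' (fun K hK => hC hK.1) hC').trans ?_)
    rw [← ENNReal.tsum_mul_left]
    refine ENNReal.tsum_le_tsum fun K => ?_
    rw [hsplit]
    have h1 : 0 ≤ η' - η := by linarith
    gcongr
    exact K.2.2
  have hne0 : ν D ^ (η' - η) ≠ 0 :=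
    (ENNReal.rpow_pos (pos_iff_ne_zero.2 h0) (measure_ne_top _ _)).ne'
  have hnet : ν D ^ (η' - η) ≠ ⊤ :=
    ENNReal.rpow_ne_top_of_nonneg (by linarith) (measure_ne_top _ _)
  refine ((ENNReal.mul_le_mul_iff_right hne0 hnet).1 hle).trans ?_
  exact ENNReal.tsum_mono_subtype (fun K => ν K ^ η) fun K hK => hK.1

lemma frontier_dyadicCube_subset (p : EuclideanSpace ℝ (Fin d)) (m : ℤ) (k : Fin d → ℤ) :
    frontier (dyadicCube p m k) ⊆
      ⋃ i, ⋃ j : ℤ, {x : EuclideanSpace ℝ (Fin d) | x i = p i + j * (2 : ℝ) ^ (-m)} := by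
  intro x hx
  by_contra hcon
  simp only [Set.mem_iUnion, Set.mem_ofPred_eq, not_exists] at hcon
  have hc : ∀ i, Continuous fun x : EuclideanSpace ℝ (Fin d) => x i := fun i => by fun_prop
  by_cases hin : ∀ i, p i + k i * (2 : ℝ) ^ (-m) < x i ∧ x i < p i + (k i + 1) * (2 : ℝ) ^ (-m)
  · have hx2 : x ∉ interior (dyadicCube p m k) := hx.2
    rw [mem_interior] at hx2
    refine hx2 ⟨⋂ i, ({x : EuclideanSpace ℝ (Fin d) |
      p i + k i * (2 : ℝ) ^ (-m) < x i} ∩ {x : EuclideanSpace ℝ (Fin d) |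
      x i < p i + (k i + 1) * (2 : ℝ) ^ (-m)}), ?_, ?_, ?_⟩
    · intro y hy i
      have := Set.mem_iInter.1 hy i
      exact ⟨this.1.le, this.2⟩
    · exact isOpen_iInter_of_finite fun i => (isOpen_lt continuous_const (hc i)).inter
        (isOpen_lt (hc i) continuous_const)
    · exact Set.mem_iInter.2 hin
  · push Not at hin
    obtain ⟨i, hi⟩ := hin
    have hcl : x ∈ {x : EuclideanSpace ℝ (Fin d) | p i + k i * (2 : ℝ) ^ (-m) ≤ x i} ∩
        {x : EuclideanSpace ℝ (Fin d) | x i ≤ p i + (k i + 1) * (2 : ℝ) ^ (-m)} :=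
      closure_minimal (fun y hy => Set.mem_inter (hy i).1 (hy i).2.le)
        ((isClosed_le continuous_const (hc i)).inter (isClosed_le (hc i) continuous_const)) hx.1
    have h1 : p i + k i * (2 : ℝ) ^ (-m) < x i := lt_of_le_of_ne hcl.1 fun h => hcon i (k i) h.symm
    have h2 := hcon i (k i + 1)
    push_cast at h2
    exact h2 (le_antisymm hcl.2 (hi h1))

/-- There is a dyadic grid whose cubes all have null boundary. -/
lemma exists_measure_dyadicBoundary_eq_zero (μ : Measure (EuclideanSpace ℝ (Fin d)))
    [IsFiniteMeasure μ] : ∃ p, μ (dyadicBoundary p) = 0 := by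
  have hc : ∀ i, Continuous fun x : EuclideanSpace ℝ (Fin d) => x i := fun i => by fun_prop
  -- Parallel hyperplanes are disjoint, so only countably many are charged; a suitable base
  -- coordinate avoids their countably many dyadic translates.
  have hcount : ∀ i, {c : ℝ | 0 < μ {x | x i = c}}.Countable := fun i =>
    Measure.countable_meas_pos_of_disjoint_iUnion
      (As := fun c : ℝ => {x : EuclideanSpace ℝ (Fin d) | x i = c})
      (fun c => (isClosed_eq (hc i) continuous_const).measurableSet)
      (fun a b hab => Set.disjoint_left.2 fun x (hx : x i = a) (hy : x i = b) => hab (hx ▸ hy))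
  have hex : ∀ i, ∃ c : ℝ, ∀ j m : ℤ, μ {x | x i = c + j * (2 : ℝ) ^ (-m)} = 0 := by
    intro i
    have hbad : (⋃ j : ℤ, ⋃ m : ℤ, (fun c : ℝ => c - j * (2 : ℝ) ^ (-m)) ''
        {c : ℝ | 0 < μ {x | x i = c}}).Countable :=
      Set.countable_iUnion fun j => Set.countable_iUnion fun m => (hcount i).image _
    obtain ⟨c, hcn⟩ := (hbad.dense_compl ℝ).nonempty
    refine ⟨c, fun j m => ?_⟩
    by_contra hpos
    refine hcn (Set.mem_iUnion.2 ⟨j, Set.mem_iUnion.2 ⟨m, c + j * (2 : ℝ) ^ (-m),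
      pos_iff_ne_zero.2 hpos, by ring⟩⟩)
  choose c hcz using hex
  refine ⟨WithLp.toLp 2 c, ?_⟩
  rw [dyadicBoundary, measure_biUnion_null_iff (countable_dyadicCubes _)]
  rintro D ⟨m, k, rfl⟩
  refine measure_mono_null (frontier_dyadicCube_subset _ m k) ?_
  simp only [measure_iUnion_null_iff]
  exact fun i j => hcz i j m

/-! ### From net content to Hausdorff dimension -/

/-- The outer measure that is generated by the cost `ν D ^ η` of dyadic cubes. -/
def netOuterMeasure (p : EuclideanSpace ℝ (Fin d)) (ν : Measure (EuclideanSpace ℝ (Fin d)))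
    {η : ℝ} (hη : 0 < η) : OuterMeasure (EuclideanSpace ℝ (Fin d)) := by
  classical
  exact OuterMeasure.ofFunction (fun D => if D ∈ dyadicCubes p ∪ {∅} then ν D ^ η else ⊤)
    (by simp [hη])

lemma netOuterMeasure_le {p : EuclideanSpace ℝ (Fin d)}
    (ν : Measure (EuclideanSpace ℝ (Fin d))) {η : ℝ} (hη : 0 < η)
    {D : Set (EuclideanSpace ℝ (Fin d))} (hD : D ∈ dyadicCubes p) :
    netOuterMeasure p ν hη D ≤ ν D ^ η := by
  refine (OuterMeasure.ofFunction_le D).trans ?_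
  rw [if_pos (show D ∈ dyadicCubes p ∪ {∅} from Or.inl hD)]

/-- Dropping repetitions and empty sets from a sequence of cubes only lowers the cost. The outer
measure provides the subadditivity needed for comparison with Hausdorff measure. -/
lemma netContent_le_netOuterMeasure (p : EuclideanSpace ℝ (Fin d))
    (ν : Measure (EuclideanSpace ℝ (Fin d))) {η : ℝ} (hη : 0 < η)
    (E : Set (EuclideanSpace ℝ (Fin d))) : netContent p ν η E ≤ netOuterMeasure p ν hη E := by
  classical
  rw [netOuterMeasure, OuterMeasure.ofFunction_apply]
  refine le_iInf₂ fun f hf => ?_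
  by_cases hall : ∀ n, f n ∈ dyadicCubes p ∪ {∅}
  · let C : Set (Set (EuclideanSpace ℝ (Fin d))) := Set.range f ∩ dyadicCubes p
    have hcov : E ⊆ ⋃₀ C := by
      intro x hx
      obtain ⟨n, hn⟩ := Set.mem_iUnion.1 (hf hx)
      refine ⟨f n, ⟨⟨n, rfl⟩, (hall n).resolve_right fun h => ?_⟩, hn⟩
      rw [Set.mem_singleton_iff.1 h] at hn
      exact hn
    calc netContent p ν η E ≤ ∑' D : C, ν (D : Set (EuclideanSpace ℝ (Fin d))) ^ η :=
          le_netContent_iff.1 le_rfl C Set.inter_subset_right hcov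
      _ ≤ ∑' D : ↑(⋃ n, {f n}), ν (D : Set (EuclideanSpace ℝ (Fin d))) ^ η := by
          refine ENNReal.tsum_mono_subtype (fun K => ν K ^ η) ?_
          rintro D ⟨⟨n, rfl⟩, -⟩
          exact Set.mem_iUnion.2 ⟨n, rfl⟩
      _ ≤ ∑' n, ∑' D : ({f n} : Set (Set (EuclideanSpace ℝ (Fin d)))),
            ν (D : Set (EuclideanSpace ℝ (Fin d))) ^ η :=
          ENNReal.tsum_iUnion_le_tsum (fun K => ν K ^ η) _
      _ = ∑' n, if f n ∈ dyadicCubes p ∪ {∅} then ν (f n) ^ η else ⊤ := by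
          refine tsum_congr fun n => ?_
          rw [tsum_singleton (f n) (fun K => ν K ^ η), if_pos (hall n)]
  · push Not at hall
    obtain ⟨n, hn⟩ := hall
    rw [ENNReal.tsum_eq_top_of_eq_top ⟨n, if_neg hn⟩]
    exact le_top

/-- A set of full net content for `μ.restrict A` has large Hausdorff dimension, if `μ` satisfies a
Frostman condition at the points of a dense subset of `A`. -/
theorem le_dimH_of_le_netContent {p : EuclideanSpace ℝ (Fin d)}
    {μ : Measure (EuclideanSpace ℝ (Fin d))} {A' : Set (EuclideanSpace ℝ (Fin d))}
    {τ η R : ℝ} (hτ : 0 < τ) (hη : 0 < η) (hR : 0 < R)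
    (hA' : ∀ x ∈ A', ∀ r, 0 < r → r < R → μ (Metric.ball x r) ≤ ENNReal.ofReal (r ^ τ))
    (hpos : μ.restrict (closure A') ≠ 0) {E : Set (EuclideanSpace ℝ (Fin d))}
    (hE : ∀ D ∈ dyadicCubes p, μ.restrict (closure A') D ^ η ≤
      netContent p (μ.restrict (closure A')) η (E ∩ D)) :
    ENNReal.ofReal (τ * η) ≤ dimH E := by
  set ν := μ.restrict (closure A') with hν
  set N := netOuterMeasure p ν hη with hN
  -- A cube of side below `2ρ` that meets `closure A'` lies within `d + 1` sides of a point of `A'`,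
  -- hence in a ball of radius `b ρ` to which the Frostman bound applies.
  set b : ℝ := 2 * (d + 2) with hb
  have hb0 : 0 < b := by positivity
  set c : ℝ≥0∞ := 3 ^ d * ENNReal.ofReal (b ^ (τ * η)) with hc
  have hc0 : c ≠ 0 := mul_ne_zero (by simp) (ENNReal.ofReal_pos.2 (by positivity)).ne'
  have hctop : c ≠ ⊤ := by finiteness
  have hcube : ∀ (m : ℤ) (k : Fin d → ℤ) (ρ : ℝ), 0 < ρ → (2 : ℝ) ^ (-m) < 2 * ρ → b * ρ < R →
      N (dyadicCube p m k) ≤ ENNReal.ofReal (b ^ (τ * η)) * ENNReal.ofReal (ρ ^ (τ * η)) := by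
    intro m k ρ hρ hm hρR
    refine (netOuterMeasure_le ν hη (dyadicCube_mem p m k)).trans ?_
    rw [← ENNReal.ofReal_mul (by positivity), ← Real.mul_rpow hb0.le hρ.le,
      Real.rpow_mul (by positivity), ← ENNReal.ofReal_rpow_of_nonneg (by positivity) hη.le]
    gcongr
    by_cases hne : (dyadicCube p m k ∩ closure A').Nonempty
    · obtain ⟨z, hz, hzA⟩ := hne
      have h2 : (0 : ℝ) < 2 ^ (-m) := by positivity
      obtain ⟨y, hy, hzy⟩ := Metric.mem_closure_iff.1 hzA _ h2
      have hball : dyadicCube p m k ⊆ Metric.ball y (b * ρ) := by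
        intro x hx
        have h1 := dist_le_of_mem_dyadicCube hx hz
        have h3 := dist_triangle x z y
        rw [Metric.mem_ball]
        have hd : (0 : ℝ) ≤ d := d.cast_nonneg
        nlinarith
      calc ν (dyadicCube p m k) ≤ μ (dyadicCube p m k) := Measure.restrict_le_self _
        _ ≤ μ (Metric.ball y (b * ρ)) := measure_mono hball
        _ ≤ _ := hA' y hy _ (by positivity) hρR
    · rw [hν, Measure.restrict_apply (measurableSet_gridCube p _ k),
        Set.not_nonempty_iff_eq_empty.1 hne, measure_empty]
      exact zero_le
  have hsmall : ∀ (S : Set (EuclideanSpace ℝ (Fin d))) (x : EuclideanSpace ℝ (Fin d)) (ρ : ℝ),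
      0 < ρ → b * ρ < R → (∀ y ∈ S, dist y x ≤ ρ) → N S ≤ c * ENNReal.ofReal (ρ ^ (τ * η)) := by
    intro S x ρ hρ hρR hS
    -- Cubes of side `2^(n+1)`, with `ρ ≤ 2^(n+1) < 2ρ`: the one containing `x` and its neighbours,
    -- `3^d` in all, cover `S`.
    obtain ⟨n, hn1, hn2⟩ := exists_mem_Ioc_zpow hρ (one_lt_two)
    let e : Finset (Fin d → ℤ) := Fintype.piFinset fun _ => Finset.Icc (-1 : ℤ) 1
    have he : e.card = 3 ^ d := by simp [e]
    have hcov : S ⊆ ⋃ k ∈ e, dyadicCube p (-(n + 1)) fun i => cubeIdx p (-(n + 1)) x i + k i := by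
      intro y hy
      simp only [Set.mem_iUnion]
      refine ⟨fun i => cubeIdx p (-(n + 1)) y i - cubeIdx p (-(n + 1)) x i,
        Fintype.mem_piFinset.2 fun i => ?_, mem_dyadicCube_iff.2 (by funext i; ring)⟩
      have h1 : |y i - x i| ≤ ρ := by
        have := (PiLp.norm_apply_le (y - x) i)
        rw [PiLp.sub_apply, Real.norm_eq_abs] at this
        exact this.trans ((dist_eq_norm y x).symm.le.trans (hS y hy))
      have h2 : |(y i - p i) * 2 ^ (-(n + 1)) - (x i - p i) * 2 ^ (-(n + 1))| ≤ (1 : ℝ) := by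
        rw [← sub_mul, abs_mul, sub_sub_sub_cancel_right, zpow_neg,
          abs_of_pos (show (0 : ℝ) < (2 ^ (n + 1))⁻¹ by positivity), ← div_eq_mul_inv,
          div_le_one (by positivity)]
        exact h1.trans hn2
      rw [abs_le] at h2
      simp only [cubeIdx, Finset.mem_Icc]
      have h3 := Int.floor_le ((y i - p i) * (2 : ℝ) ^ (-(n + 1)))
      have h4 := Int.lt_floor_add_one ((y i - p i) * (2 : ℝ) ^ (-(n + 1)))
      have h5 := Int.floor_le ((x i - p i) * (2 : ℝ) ^ (-(n + 1)))
      have h6 := Int.lt_floor_add_one ((x i - p i) * (2 : ℝ) ^ (-(n + 1)))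
      have h7 : ⌊(x i - p i) * (2 : ℝ) ^ (-(n + 1))⌋ < ⌊(y i - p i) * (2 : ℝ) ^ (-(n + 1))⌋ + 2 := by
        rw [← Int.cast_lt (R := ℝ)]
        push_cast
        linarith
      have h8 : ⌊(y i - p i) * (2 : ℝ) ^ (-(n + 1))⌋ < ⌊(x i - p i) * (2 : ℝ) ^ (-(n + 1))⌋ + 2 := by
        rw [← Int.cast_lt (R := ℝ)]
        push_cast
        linarith
      omega
    calc N S ≤ ∑ k ∈ e, N (dyadicCube p (-(n + 1)) fun i => cubeIdx p (-(n + 1)) x i + k i) :=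
          (measure_mono hcov).trans (measure_biUnion_finset_le _ _)
      _ ≤ e.card • (ENNReal.ofReal (b ^ (τ * η)) * ENNReal.ofReal (ρ ^ (τ * η))) := by
          refine Finset.sum_le_card_nsmul _ _ _ fun k _ => hcube _ _ ρ hρ ?_ hρR
          rw [neg_neg, zpow_add_one₀ (by norm_num)]
          linarith
      _ = c * ENNReal.ofReal (ρ ^ (τ * η)) := by
          rw [he, nsmul_eq_mul, hc]
          push_cast
          ring
  have hτη : 0 < τ * η := mul_pos hτ hη
  have hle : N ≤ OuterMeasure.mkMetric (c • fun x : ℝ≥0∞ => x ^ (τ * η)) := by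
    refine OuterMeasure.le_mkMetric _ N (ENNReal.ofReal (R / b / 2))
      (ENNReal.ofReal_pos.2 (by positivity)) fun S hS => ?_
    rcases S.eq_empty_or_nonempty with rfl | ⟨x, hx⟩
    · simp
    have hdtop : Metric.ediam S ≠ ⊤ := (hS.trans_lt ENNReal.ofReal_lt_top).ne
    set δ := (Metric.ediam S).toReal with hδ
    have hδR : δ ≤ R / b / 2 := ENNReal.toReal_le_of_le_ofReal (by positivity) hS
    -- Radii slightly above the diameter are used because the diameter may be zero.
    have hlim : Tendsto (fun ρ : ℝ => c * ENNReal.ofReal (ρ ^ (τ * η))) (𝓝[>] δ)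
        (𝓝 (c * ENNReal.ofReal (δ ^ (τ * η)))) := by
      refine ENNReal.Tendsto.const_mul (ENNReal.tendsto_ofReal ?_) (Or.inr hctop)
      exact ((Real.continuous_rpow_const hτη.le).tendsto δ).mono_left nhdsWithin_le_nhds
    have heq : (c • fun x : ℝ≥0∞ => x ^ (τ * η)) (Metric.ediam S) =
        c * ENNReal.ofReal (δ ^ (τ * η)) := by
      rw [Pi.smul_apply, smul_eq_mul, ← ENNReal.ofReal_rpow_of_nonneg ENNReal.toReal_nonneg hτη.le,
        ENNReal.ofReal_toReal hdtop]
    rw [heq]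
    refine ge_of_tendsto hlim ?_
    have hδR' : δ < R / b := hδR.trans_lt (half_lt_self (by positivity))
    filter_upwards [self_mem_nhdsWithin, nhdsWithin_le_nhds (eventually_lt_nhds hδR')] with ρ h1 h2
    have h1 : δ < ρ := h1
    refine hsmall S x ρ (ENNReal.toReal_nonneg.trans_lt h1) ?_ fun y hy => ?_
    · rw [mul_comm]
      exact (lt_div_iff₀ hb0).1 h2
    · refine le_trans ?_ h1.le
      rw [dist_edist]
      exact ENNReal.toReal_mono hdtop (Metric.edist_le_ediam_of_mem hy hx)
  have hD : ∃ k, ν (dyadicCube p 0 k) ≠ 0 := by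
    by_contra! hcon
    refine hpos (Measure.measure_univ_eq_zero.1 ?_)
    refine measure_mono_null (fun x _ => Set.mem_iUnion.2 ⟨cubeIdx p 0 x, mem_cubeAt p 0 x⟩)
      (measure_iUnion_null hcon)
  obtain ⟨k, hk⟩ := hD
  refine le_dimH_of_hausdorffMeasure_ne_zero fun hzero => ?_
  have hNE : N E = 0 := by
    refine le_antisymm ((hle E).trans ?_) zero_le
    rw [OuterMeasure.mkMetric_smul _ hctop hc0, smul_apply, OuterMeasure.coe_mkMetric]
    rw [Measure.hausdorffMeasure, Real.coe_toNNReal _ hτη.le] at hzero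
    rw [hzero, smul_zero]
  have h0 : ν (dyadicCube p 0 k) ^ η ≤ 0 := by
    refine (hE _ (dyadicCube_mem p 0 k)).trans ((netContent_le_netOuterMeasure p ν hη _).trans ?_)
    rw [← hNE]
    exact measure_mono Set.inter_subset_left
  have h1 := (ENNReal.rpow_eq_zero_iff_of_pos hη).1 (le_antisymm h0 zero_le)
  exact hk h1

/-- A lower bound for the lower local dimension gives upper bounds for the measures of balls. -/
lemma eventually_measure_ball_le {μ : Measure (EuclideanSpace ℝ (Fin d))} {τ : ℝ}
    {x : EuclideanSpace ℝ (Fin d)} (h : (τ : EReal) < lowerLocalDim μ x) :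
    ∀ᶠ r in 𝓝[>] (0 : ℝ), μ (Metric.ball x r) ≤ ENNReal.ofReal (r ^ τ) := by
  have h1 : ∀ᶠ r : ℝ in 𝓝[>] (0 : ℝ), r < 1 :=
    eventually_nhdsWithin_of_eventually_nhds (eventually_lt_nhds one_pos)
  filter_upwards [eventually_lt_of_lt_liminf h, h1, self_mem_nhdsWithin] with r hr hr1 hr0
  have hr0 : 0 < r := hr0
  have hlog : Real.log r < 0 := Real.log_neg hr0 hr1
  have hlog' : ((Real.log r : ℝ) : EReal) < 0 := by exact_mod_cast hlog
  by_contra! hcon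
  refine absurd hr (not_lt.2 ?_)
  have h2 : ((τ * Real.log r : ℝ) : EReal) ≤ ENNReal.log (μ (Metric.ball x r)) := by
    have h3 := (ENNReal.log_lt_log hcon).le
    rwa [ENNReal.log_ofReal_of_pos (by positivity), Real.log_rpow hr0] at h3
  refine (EReal.div_le_div_right_of_nonpos hlog'.le h2).trans ?_
  rw [← EReal.coe_div, mul_div_assoc, div_self hlog.ne, mul_one]

/-- If `τ` is less than the upper Hausdorff dimension of `μ`, then some set whose closure is not
null satisfies a uniform Frostman condition with exponent `τ`. -/
lemma exists_frostman_set {μ : Measure (EuclideanSpace ℝ (Fin d))} {τ : ℝ}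
    (h : (τ : EReal) < upperHausdorffDim μ) :
    ∃ A : Set (EuclideanSpace ℝ (Fin d)), ∃ R > 0, μ.restrict (closure A) ≠ 0 ∧
      ∀ x ∈ A, ∀ r, 0 < r → r < R → μ (Metric.ball x r) ≤ ENNReal.ofReal (r ^ τ) := by
  -- These sets exhaust the points of lower local dimension above `τ`, so not all are null. Their
  -- closures provide a measurable set to restrict to.
  let A : ℕ → Set (EuclideanSpace ℝ (Fin d)) := fun j =>
    {x | ∀ r, 0 < r → r < 1 / ((j : ℝ) + 1) → μ (Metric.ball x r) ≤ ENNReal.ofReal (r ^ τ)}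
  by_contra! hcon
  have hnull : ∀ j, μ (A j) = 0 := by
    intro j
    by_contra hj
    obtain ⟨x, hx, r, hr0, hr, hlt⟩ := hcon (A j) (1 / ((j : ℝ) + 1)) (by positivity) fun h0 =>
      hj (measure_mono_null subset_closure (Measure.restrict_eq_zero.1 h0))
    exact absurd (hx r hr0 hr) (not_le.2 hlt)
  refine absurd h (not_lt.2 (essSup_le_of_ae_le _ ?_))
  have hae : ∀ᵐ x ∂μ, x ∉ ⋃ j, A j := by
    rw [← measure_eq_zero_iff_ae_notMem]
    exact measure_iUnion_null hnull
  filter_upwards [hae] with x hx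
  by_contra! hτ
  refine hx ?_
  obtain ⟨u, hu, hur⟩ := mem_nhdsGT_iff_exists_Ioo_subset.1 (eventually_measure_ball_le hτ)
  obtain ⟨j, hj⟩ := exists_nat_one_div_lt (show (0 : ℝ) < u from hu)
  exact Set.mem_iUnion.2 ⟨j, fun r h0 hr => hur ⟨h0, hr.trans hj⟩⟩

/-! ### Almost sure full content and conclusion -/

section

variable {μ : Measure (EuclideanSpace ℝ (Fin d))} [IsProbabilityMeasure μ]
  {Ω : Type*} [MeasurableSpace Ω] {P : Measure Ω} [IsProbabilityMeasure P]
  {X : ℕ → Ω → EuclideanSpace ℝ (Fin d)}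

/-- Almost surely the limsup set has full net content, for the restriction of the measure to any
fixed set and all exponents that are small compared to the critical exponent. -/
theorem ae_le_netContent_of_mul_criticalExponent_lt (hX : ∀ n, Measurable (X n))
    (hindep : iIndepFun X P) (hlaw : ∀ n, P.map (X n) = μ) {α : ℝ} (hα : 0 < α) {s : ℝ}
    (hs : criticalExponent μ = (s : EReal))
    {p : EuclideanSpace ℝ (Fin d)} (hp : μ (dyadicBoundary p) = 0)
    {A : Set (EuclideanSpace ℝ (Fin d))} (hA : MeasurableSet A) {η : ℝ} (hη0 : 0 < η)
    (hη1 : η ≤ 1) (hηs : η * s < 1 / α) :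
    ∀ᵐ ω ∂P, ∀ D ∈ dyadicCubes p, μ.restrict A D ^ η ≤
      netContent p (μ.restrict A) η (limsupBalls α (fun n => X n ω) ∩ D) := by
  have hs' : s < 1 / α / η := by rwa [lt_div_iff₀ hη0, mul_comm]
  -- Two exponents above `s`: `t` for the light cubes of `μ` in the grid at `0`, and `t' > t` to pay
  -- for changing the grid and restricting the measure.
  obtain ⟨t', hst', ht'⟩ := exists_between hs'
  obtain ⟨t, hst, htt'⟩ := exists_between hst'
  refine ae_le_netContent_limsupBalls hX hindep hlaw hα hp hA hη0 hη1
    (by rwa [lt_div_iff₀ hη0, mul_comm] at ht') ?_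
  exact tendsto_measure_restrict_light htt'
    (tendsto_measure_light μ (by rw [hs]; exact_mod_cast hst)) p A

end

end RandomLimsup

end

/-- The random limsup set of balls `B(x_n, n^{-α})` with independent centres of law `μ`: if
`1/α ≤ s = s(μ) < ∞`, then almost surely it lies in the class `G_μ^θ`, `θ = 1/(α s)` (for dyadic
cubes whose boundaries are `μ`-null), and its Hausdorff dimension is at least
`(1/α) * (upper Hausdorff dimension of μ) / s`. -/
theorem theorem2p7 {d : ℕ} (μ : Measure (EuclideanSpace ℝ (Fin d))) [IsProbabilityMeasure μ]
    {Ω : Type*} [MeasurableSpace Ω] (P : Measure Ω) [IsProbabilityMeasure P]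
    (X : ℕ → Ω → EuclideanSpace ℝ (Fin d)) (hX : ∀ n, Measurable (X n))
    (hindep : iIndepFun X P) (hlaw : ∀ n, P.map (X n) = μ)
    (α : ℝ) (hα : 0 < α)
    (s : ℝ) (hs : RandomLimsup.criticalExponent μ = (s : EReal)) (hαs : 1 / α ≤ s) :
    (∀ p : EuclideanSpace ℝ (Fin d), μ (RandomLimsup.dyadicBoundary p) = 0 →
      ∀ᵐ ω ∂P, RandomLimsup.limsupBalls α (fun n => X n ω) ∈
        RandomLimsup.classG p μ (α * s)⁻¹) ∧
    ∀ᵐ ω ∂P, ((1 / α : ℝ) : EReal) * (RandomLimsup.upperHausdorffDim μ / (s : EReal)) ≤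
      ((dimH (RandomLimsup.limsupBalls α (fun n => X n ω)) : ℝ≥0∞) : EReal) := by
  open RandomLimsup in
  have hs0 : 0 < s := (one_div_pos.2 hα).trans_le hαs
  set θ := (α * s)⁻¹ with hθ
  have hθ0 : 0 < θ := by positivity
  have hθs : θ * s = 1 / α := by
    rw [hθ]
    field_simp
  have hθ1 : θ ≤ 1 := by
    rw [div_le_iff₀ hα] at hαs
    exact inv_le_one_of_one_le₀ (by linarith)
  -- Countably many exponents keep the exceptional events countable; the remaining ones follow from
  -- `le_netContent_of_exponent_le`.
  obtain ⟨η, -, hηmem, hηlim⟩ := exists_seq_strictMono_tendsto' hθ0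
  have hηs : ∀ j, η j * s < 1 / α := fun j => by
    rw [← hθs]
    exact mul_lt_mul_of_pos_right (hηmem j).2 hs0
  have hη1 : ∀ j, η j ≤ 1 := fun j => (hηmem j).2.le.trans hθ1
  constructor
  · intro p hp
    have hall := ae_all_iff.2 fun j => ae_le_netContent_of_mul_criticalExponent_lt hX hindep hlaw hα
      hs hp MeasurableSet.univ (hηmem j).1 (hη1 j) (hηs j)
    simp only [Measure.restrict_univ] at hall
    filter_upwards [hall] with ω hω
    refine ⟨?_, fun η' hη'0 hη'θ D hD => le_antisymm (netContent_mono p μ η' Set.inter_subset_right)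
      ((netContent_le_of_mem μ η' hD).trans ?_)⟩
    · rw [limsupBalls_eq_iInter]
      exact IsGδ.iInter_of_isOpen fun N => isOpen_tailBalls α _ N
    · obtain ⟨j, hj⟩ := (hηlim.eventually_const_lt hη'θ).exists
      exact le_netContent_of_exponent_le hη'0 hj.le hD (hω j D hD)
  · obtain ⟨p, hp⟩ := exists_measure_dyadicBoundary_eq_zero μ
    -- The Frostman set depends on the exponent `q`, so rational exponents keep the number of
    -- exceptional events countable.
    have hall : ∀ᵐ ω ∂P, ∀ (q : ℚ) (j : ℕ), 0 < q → ((q : ℝ) : EReal) < upperHausdorffDim μ →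
        ENNReal.ofReal (q * η j) ≤ dimH (limsupBalls α (fun n => X n ω)) := by
      refine ae_all_iff.2 fun q => ae_all_iff.2 fun j => ?_
      by_cases hq : 0 < q ∧ ((q : ℝ) : EReal) < upperHausdorffDim μ
      · obtain ⟨A, R, hR, hpos, hA⟩ := exists_frostman_set hq.2
        filter_upwards [ae_le_netContent_of_mul_criticalExponent_lt hX hindep hlaw hα
          hs hp isClosed_closure.measurableSet (hηmem j).1 (hη1 j) (hηs j)] with ω hω _ _
        exact le_dimH_of_le_netContent (by exact_mod_cast hq.1) (hηmem j).1 hR hA hpos hω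
      · exact ae_of_all _ fun ω h1 h2 => absurd ⟨h1, h2⟩ hq
    filter_upwards [hall] with ω hω
    rcases eq_or_ne (dimH (limsupBalls α fun n => X n ω)) ⊤ with htop | htop
    · rw [htop]
      exact le_top
    set x := (dimH (limsupBalls α fun n => X n ω)).toReal with hx
    have hx0 : 0 ≤ x := ENNReal.toReal_nonneg
    have hxe : ((dimH (limsupBalls α fun n => X n ω) : ℝ≥0∞) : EReal) = (x : EReal) := by
      rw [hx, EReal.coe_ennreal_toReal htop]
    -- Otherwise a rational `q` lies strictly between, and `q * η j ≤ x` for all `j` gives `q * θ ≤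
    -- x` in the limit.
    have hU : upperHausdorffDim μ ≤ ((x * α * s : ℝ) : EReal) := by
      by_contra! hcon
      obtain ⟨q, hq1, hq2⟩ := EReal.lt_iff_exists_rat_btwn.1 hcon
      have hq1' : x * α * s < q := by exact_mod_cast hq1
      have hq0 : (0 : ℝ) < q := lt_of_le_of_lt (by positivity) hq1'
      have hle : ∀ j, q * η j ≤ x := fun j =>
        (ENNReal.ofReal_le_iff_le_toReal htop).1 (hω q j (by exact_mod_cast hq0) hq2)
      have hlim : (q : ℝ) * θ ≤ x := le_of_tendsto' (hηlim.const_mul (q : ℝ)) hle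
      rw [hθ, ← div_eq_mul_inv, div_le_iff₀ (by positivity)] at hlim
      linarith
    rw [hxe]
    calc ((1 / α : ℝ) : EReal) * (upperHausdorffDim μ / (s : EReal))
        ≤ ((1 / α : ℝ) : EReal) * (((x * α * s : ℝ) : EReal) / (s : EReal)) := by
          refine mul_le_mul_of_nonneg_left (EReal.div_le_div_right_of_nonneg ?_ hU) ?_
          · exact_mod_cast hs0.le
          · exact_mod_cast (one_div_pos.2 hα).le
      _ = (x : EReal) := by
          rw [← EReal.coe_div, ← EReal.coe_mul]
          congr 1
          field_simp
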